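/- Setting. Let $d\ge 2$, let $X\subseteq\mathbb R^d$ be closed and convex, let $\zeta$ be a random element of $\Xi$ and $F:\mathbb R^d\times\Xi\to\mathbb R$ such that $f(\mathbf x)=\mathbb E[F(\mathbf x,\zeta)]$ is finite and everywhere differentiable, $F(\cdot,\zeta)$ is everywhere differentiable for every $\zeta$, and $\mathbb E[\nabla F(\mathbf x,\zeta)]=\nabla f(\mathbf x)$ for $\mathbf x\in X$. Suppose that for some $\sigma_\infty>0$, $L>0$, $\underline f\in\mathbb R$ and all $\mathbf x,\mathbf y\in X$: $\mathbb E\|\nabla F(\mathbf x,\zeta)-\nabla f(\mathbf x)\|_\infty^2\le\sigma_\infty^2$, $\mathbb E\|\nabla F(\mathbf x,\zeta)-\nabla F(\mathbf y,\zeta)\|_\infty^2\le L^2\|\mathbf x-\mathbf y\|_1^2$ and $f(\mathbf x)\ge\underline f$. Algorithm. Given $K,q,m,m_1\in\mathbb N$, $\eta,\hat\rho>0$ and a (possibly random) $\mathbf x^1\in X$, for $k=1,\dots,K$ let $$G^k=\frac1{m_1}\sum_{i=1}^{m_1}\nabla F(\mathbf x^k,\zeta^k_i)\ \text{ if }k\equiv1\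 (\mathrm{mod}\ q),\qquad G^k=\frac1m\sum_{i=1}^{m}\bigl(\nabla F(\mathbf x^k,\zeta^k_i)-\nabla F(\mathbf x^{k-1},\zeta^k_i)\bigr)+G^{k-1}\ \text{ otherwise,}$$ $$\mathbf x^{k+1}=\arg\min_{\mathbf x\in X}\Bigl\{\tfrac12\|\mathbf x-(\mathbf x^k-\eta G^k)\|_2^2+\tfrac{\hat\rho}2\|\mathbf x-\mathbf x^k\|_1^2\Bigr\},$$ where the $\zeta_i^k$ are i.i.d. copies of $\zeta$, independent of $\mathbf x^1$. The output is $\mathbf x^{Y+1}$, where $Y$ is uniform on $\{1,\dots,K\}$ and independent of $\mathbf x^1$ and the samples. Let $\Omega=e^2\log d$ and $\Delta_f=\mathbb E[f(\mathbf x^1)]-\underline f$, and suppose that $0<\Delta_f<\infty$. Write $\delta_X$ for the function that is $0$ on $X$ and $+\infty$ elsewhere, $\partial$ for the (regular) subdifferential, and $\mathrm{dist}_{\|\cdot\|_\infty}(0,A)=\inf_{\mathbf v\in A}\|\mathbf v\|_\infty$. Claim. Let $c>0$ be a numerical constant (for instance $c=e^2$). There is a constant $C$, depending only on $c$, such that in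 every such setting and for every $\epsilon>0$ and $\hat\rho\ge6$ the following holds with $$\eta=\frac1L,\quad K=\Bigl\lceil\frac{\Delta_fL}{\epsilon^2}\Bigr\rceil,\quad m_1=\Bigl\lceil\frac{\Omega\,c(\log d)\,\sigma_\infty^2}{\epsilon^2}\Bigr\rceil,\quad q=\Bigl\lceil\frac{\sqrt{m_1}}{\Omega}\Bigr\rceil,\quad m=\lceil q\,\Omega^2\rceil$$ (that is, $m=q\Omega^2$ and $mq=m_1$ up to rounding). 1. $\mathbb E\bigl[\mathrm{dist}_{\|\cdot\|_\infty}(0,\partial(f+\delta_X)(\mathbf x^{Y+1}))\bigr]\le C\sqrt{\hat\rho}\,\epsilon$; so for each fixed value of $\hat\rho$, for instance $\hat\rho=6$, it is at most an absolute constant times $\epsilon$. 2. The number of samples drawn is at most $Km+\lceil K/q\rceil m_1$, which is at most $3Km$ whenever $q\le K$. 3. If $\epsilon\le\sigma_\infty$ and $\epsilon\,\sigma_\infty\le\Delta_fL$ (as holds for all small enough $\epsilon$), then $Km+\lceil K/q\rceil m_1$ and $3Km$ are both at most $C\,\Delta_fL\,\Omega^2\sigma_\infty/\epsilon^3$, and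 $Km+\lceil K/q\rceil m_1\le C\,\Delta_fL\,(\log d)^2\sigma_\infty/\epsilon^3$. -/

import Mathlib

open MeasureTheory ProbabilityTheory Topology
open scoped ENNReal

namespace DISFOM

noncomputable section

/-- `ℝ^d` with its Euclidean norm `‖·‖` and inner product. -/
abbrev Vec (d : ℕ) : Type := EuclideanSpace ℝ (Fin d)

/-- The norm `‖x‖₁ = ∑ i, |x i|`. -/
def l1Norm {d : ℕ} (x : Vec d) : ℝ := ∑ i, |x i|

/-- The norm `‖x‖_∞ = max_i |x i|` (the norm of the underlying tuple is the sup norm). -/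
def linfNorm {d : ℕ} (x : Vec d) : ℝ := ‖WithLp.ofLp x‖

/-- The constant `Ω = e² log d`. -/
def Om (d : ℕ) : ℝ := Real.exp 2 * Real.log d

/-! ### Stationarity measure -/

/-- The convex-analytic indicator function `δ_X`: zero on `X`, `+∞` outside of `X`. -/
def indicatorFn {d : ℕ} (X : Set (Vec d)) (x : Vec d) : EReal :=
  open Classical in if x ∈ X then 0 else ⊤

/-- The (regular) subdifferential of an extended-real-valued function at `x`: it is empty where
`h` is not finite, and otherwise consists of the `v` with
`h y ≥ h x + ⟨v, y - x⟩ - o(‖y - x‖)` as `y → x`. -/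
def subdifferential {d : ℕ} (h : Vec d → EReal) (x : Vec d) : Set (Vec d) :=
  {v | h x ≠ ⊤ ∧ h x ≠ ⊥ ∧ ∀ δ : ℝ, 0 < δ → ∀ᶠ y in 𝓝 x,
    h x + ((inner ℝ v (y - x) - δ * ‖y - x‖ : ℝ) : EReal) ≤ h y}

/-- The residual `dist_{‖·‖_∞}(0, ∂(f + δ_X)(x))`, with value `∞` if the subdifferential is
empty. -/
def stationarityResidual {d : ℕ} (f : Vec d → ℝ) (X : Set (Vec d)) (x : Vec d) : ℝ≥0∞ :=
  ⨅ v ∈ subdifferential (fun y => (f y : EReal) + indicatorFn X y) x,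
    ENNReal.ofReal (linfNorm v)

/-! ### The stochastic optimization problem -/

/-- The objective `f(x) = E[F(x, ζ)]`, where `ζ` has law `P`. -/
def objective {d : ℕ} {Ξ : Type*} [MeasurableSpace Ξ] (P : Measure Ξ) (F : Vec d → Ξ → ℝ)
    (x : Vec d) : ℝ :=
  ∫ z, F x z ∂P

/-- The stochastic gradient `∇F(x, ζ)`, the gradient in the first variable. -/
def stochGrad {d : ℕ} {Ξ : Type*} (F : Vec d → Ξ → ℝ) (x : Vec d) (z : Ξ) : Vec d :=
  gradient (fun y => F y z) x

/-- Standing assumptions on the problem `min_{x ∈ X} f(x)`, `f(x) = E[F(x, ζ)]`, together with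
bounded variance in `‖·‖_∞` (constant `σ`), mean-squared Lipschitz smoothness (constant `L`)
and lower boundedness of `f` on `X` (bound `flow`). -/
structure IsProblem {d : ℕ} {Ξ : Type*} [MeasurableSpace Ξ] (P : Measure Ξ)
    (X : Set (Vec d)) (F : Vec d → Ξ → ℝ) (σ L flow : ℝ) : Prop where
  /-- The feasible region is closed. -/
  isClosed : IsClosed X
  /-- The feasible region is convex. -/
  convex : Convex ℝ X
  /-- `f` is well defined and finite. -/
  integrable : ∀ x, Integrable (F x) P
  /-- `f` is everywhere differentiable. -/
  differentiable_objective : Differentiable ℝ (objective P F)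
  /-- `F(·, ζ)` is everywhere differentiable for every `ζ`. -/
  differentiable : ∀ z, Differentiable ℝ (fun x => F x z)
  /-- The stochastic gradient is a measurable function on `X × Ξ`. -/
  measurable_grad : Measurable (fun p : X × Ξ => stochGrad F (p.1 : Vec d) p.2)
  /-- The stochastic gradient is unbiased on `X`. -/
  unbiased : ∀ x ∈ X, Integrable (stochGrad F x) P ∧
    ∫ z, stochGrad F x z ∂P = gradient (objective P F) x
  /-- `E ‖∇F(x, ζ) - ∇f(x)‖_∞² ≤ σ²` on `X`. -/
  variance_le : ∀ x ∈ X,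
    ∫⁻ z, ENNReal.ofReal (linfNorm (stochGrad F x z - gradient (objective P F) x) ^ 2) ∂P
      ≤ ENNReal.ofReal (σ ^ 2)
  /-- `E ‖∇F(x, ζ) - ∇F(y, ζ)‖_∞² ≤ L² ‖x - y‖₁²` on `X`. -/
  meanSquare_lipschitz : ∀ x ∈ X, ∀ y ∈ X,
    ∫⁻ z, ENNReal.ofReal (linfNorm (stochGrad F x z - stochGrad F y z) ^ 2) ∂P
      ≤ ENNReal.ofReal (L ^ 2 * l1Norm (x - y) ^ 2)
  /-- `f` is bounded below on `X`. -/
  lower_bound : ∀ x ∈ X, flow ≤ objective P F x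

/-! ### The algorithm -/

/-- The proximal term `φ(z) = (ρ/2) ‖z‖₁²`. -/
def prox1 {d : ℕ} (ρ : ℝ) (z : Vec d) : ℝ := ρ / 2 * l1Norm z ^ 2

/-- `y ∈ argmin_{u ∈ X} { ½ ‖u - v‖² + φ(u - a) }`: `y` is the value at `v` of the proximal
projection operator with centre `a`. -/
def IsProxProj {d : ℕ} (X : Set (Vec d)) (φ : Vec d → ℝ) (a v y : Vec d) : Prop :=
  y ∈ X ∧ IsMinOn (fun u => 1 / 2 * ‖u - v‖ ^ 2 + φ (u - a)) X y

/-- The batch size `m_k`: `m₁` at the iterations `k ≡ 1 (mod q)`, `m` at the others. -/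
def batchSize (q m m₁ k : ℕ) : ℕ := if k ≡ 1 [MOD q] then m₁ else m

/-- The total number of samples drawn in the iterations `k = 1, …, K`. -/
def sampleCount (K q m m₁ : ℕ) : ℕ := ∑ k ∈ Finset.Icc 1 K, batchSize q m m₁ k

/-- `x` and `G` are the iterates and the gradient estimates of `K` iterations
(`k = 1, …, K`) of the variance-reduced method with step size `η`, proximal term
`(ρ/2)‖·‖₁²`, epoch length `q`, batch sizes `m` and `m₁`; `ζ k i` are the samples. -/
structure IsRun {d : ℕ} {Ξ S : Type*} (X : Set (Vec d)) (F : Vec d → Ξ → ℝ)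
    (η ρ : ℝ) (K q m m₁ : ℕ) (ζ : ℕ → ℕ → S → Ξ) (x G : ℕ → S → Vec d) : Prop where
  /-- The initial point is feasible. -/
  init_mem : ∀ ω, x 1 ω ∈ X
  /-- At the start of an epoch the gradient is estimated from a fresh batch. -/
  refresh : ∀ k ∈ Finset.Icc 1 K, k ≡ 1 [MOD q] → ∀ ω,
    G k ω = (batchSize q m m₁ k : ℝ)⁻¹ •
      ∑ i ∈ Finset.range (batchSize q m m₁ k), stochGrad F (x k ω) (ζ k i ω)
  /-- Otherwise the previous estimate is corrected by a batch of gradient differences. -/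
  recursion : ∀ k ∈ Finset.Icc 1 K, ¬ k ≡ 1 [MOD q] → ∀ ω,
    G k ω = (batchSize q m m₁ k : ℝ)⁻¹ •
      (∑ i ∈ Finset.range (batchSize q m m₁ k), stochGrad F (x k ω) (ζ k i ω) -
        ∑ i ∈ Finset.range (batchSize q m m₁ k), stochGrad F (x (k - 1) ω) (ζ k i ω)) +
      G (k - 1) ω
  /-- The proximal step. -/
  step : ∀ k ∈ Finset.Icc 1 K, ∀ ω,
    IsProxProj X (prox1 ρ) (x k ω) (x k ω - η • G k ω) (x (k + 1) ω)

/-- The randomness of the method: the samples `ζ k i` are i.i.d. with law `P`, the (possibly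
random) initial point `x₁` is independent of them, and the output index `Y` is uniform on
`{1, …, K}` and independent of the initial point and the samples. -/
structure IsSampling {d : ℕ} {Ξ S : Type*} [MeasurableSpace Ξ] [MeasurableSpace S]
    (P : Measure Ξ) (μ : Measure S) (K : ℕ) (ζ : ℕ → ℕ → S → Ξ) (x₁ : S → Vec d)
    (Y : S → ℕ) : Prop where
  /-- The initial point is a random variable. -/
  measurable_init : Measurable x₁
  /-- The samples are random variables. -/
  measurable_sample : ∀ k i, Measurable (ζ k i)
  /-- The output index is a random variable. -/
  measurable_index : Measurable Y
  /-- Each sample has law `P`. -/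
  law_sample : ∀ k i, μ.map (ζ k i) = P
  /-- The samples are independent. -/
  indep_samples : iIndepFun (fun p : ℕ × ℕ => ζ p.1 p.2) μ
  /-- The initial point is independent of the samples. -/
  indep_init : IndepFun x₁ (fun ω (p : ℕ × ℕ) => ζ p.1 p.2 ω) μ
  /-- The output index takes each value in `{1, …, K}` with probability `1 / K`. -/
  law_index : ∀ k ∈ Finset.Icc 1 K, μ {ω | Y ω = k} = (K : ℝ≥0∞)⁻¹
  /-- The output index is independent of everything else. -/
  indep_index : IndepFun Y (fun ω => (x₁ ω, fun p : ℕ × ℕ => ζ p.1 p.2 ω)) μ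

end

end DISFOM

namespace DISFOM

/-! The method is recursive variance reduction analysed in the dual pair `‖·‖_∞`, `‖·‖₁`; the point
is that the dimension enters only through `log d`. As `‖·‖_∞²` is not smooth, gradient errors are
measured by `V = ‖·‖_{2r}²` with `r = ⌈log d⌉`. Since `d ≤ e^r`, `‖·‖_∞² ≤ V ≤ e ‖·‖_∞²`, while a
coordinatewise Bonami inequality gives `V(v+w) + V(v-w) ≤ 2V(v) + 2(2r-1)V(w)`
(`evenNorm_two_point`). Hence, with `B = smoothConst d`, adding a conditionally centred term `H`
raises `E V` by at most `2B E‖H‖_∞²`: variances add up almost as in a Hilbert space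
(`IsSmoothPotential.lintegral_add_sum_le`).

So `E V` of the gradient error is at most `2Bσ²/m₁` at a refresh, and each correction adds at most
`8BL²/m` times the expected squared `‖·‖₁`-length of the step. Conversely a proximal step lowers `f`
by `Lρ/6` times its squared length, up to `3/(2ρL)` times the squared error (`objective_decrease`).
A step affects fewer than `q` later errors, and `8B ≤ 3Ω²`, `qΩ² ≤ m`, so the feedback coefficient
is at most `9L/(2ρ)`. For `ρ ≥ 6` this is at most three quarters of `Lρ/6` and is absorbed
(`sum_le_of_epoch_of_decrease`): on average over `k`, squared steps are of order `ε²/(ρL²)` and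
squared errors of order `ε²`.

Finally, optimality of the proximal step exhibits a subgradient of `f + δ_X` of norm at most
`(ρ+2)L‖step‖₁ + ‖error‖_∞` (`stationarityResidual_le`); Young's inequality and averaging over `Y`
give `√ρ ε`. The sample counts are arithmetic with ceilings. -/

/-! ### Even `ℓ^p` norms and their two-point inequality -/

/-- From `j` to `j + 1` the ratio of the two binomials changes by the factor `(2r-2j-1)/(2j+1)`,
which is at most `2r-1`. This compares binomial expansions coefficient by coefficient. -/
theorem choose_two_mul_le (r j : ℕ) :
    (2 * r).choose (2 * j) ≤ r.choose j * (2 * r - 1) ^ j := by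
  induction j with
  | zero => simp
  | succ j ih =>
    rcases Nat.lt_or_ge j r with hj | hj
    · have h1 := Nat.choose_succ_right_eq (2 * r) (2 * j)
      have h2 := Nat.choose_succ_right_eq (2 * r) (2 * j + 1)
      have h3 := Nat.choose_succ_right_eq r j
      obtain ⟨t, rfl⟩ : ∃ t, r = j + 1 + t := ⟨r - (j + 1), by omega⟩
      have e1 : 2 * (j + 1 + t) - 2 * j = 2 * t + 2 := by omega
      have e2 : 2 * (j + 1 + t) - (2 * j + 1) = 2 * t + 1 := by omega
      have e3 : j + 1 + t - j = t + 1 := by omega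
      have e4 : 2 * (j + 1 + t) - 1 = 2 * j + 2 * t + 1 := by omega
      rw [e1] at h1; rw [e2] at h2; rw [e3] at h3; rw [e4] at ih ⊢
      have e5 : 2 * (j + 1) = 2 * j + 1 + 1 := by ring
      rw [e5]
      have hpos : 0 < (2 * j + 1) * (2 * j + 1 + 1) := by positivity
      refine Nat.le_of_mul_le_mul_left ?_ hpos
      set A := (2 * (j + 1 + t)).choose (2 * j)
      set A1 := (2 * (j + 1 + t)).choose (2 * j + 1)
      set A2 := (2 * (j + 1 + t)).choose (2 * j + 1 + 1)
      set D := (j + 1 + t).choose j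
      set D1 := (j + 1 + t).choose (j + 1)
      calc (2 * j + 1) * (2 * j + 1 + 1) * A2 = (2 * j + 1) * (A2 * (2 * j + 1 + 1)) := by ring
        _ = (A1 * (2 * j + 1)) * (2 * t + 1) := by rw [h2]; ring
        _ = A * ((2 * t + 2) * (2 * t + 1)) := by rw [h1]; ring
        _ ≤ (D * (2 * j + 2 * t + 1) ^ j) * ((2 * t + 2) * (2 * t + 1)) := by gcongr
        _ = (D * (t + 1)) * ((2 * j + 2 * t + 1) ^ j * 2 * (2 * t + 1)) := by ring
        _ = (2 * j + 1 + 1) * (D1 * (2 * j + 2 * t + 1) ^ j * (2 * t + 1)) := by rw [← h3]; ring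
        _ ≤ (2 * j + 1 + 1) * (D1 * (2 * j + 2 * t + 1) ^ j *
              ((2 * j + 1) * (2 * j + 2 * t + 1))) := by
            gcongr; nlinarith
        _ = _ := by ring
    · rw [Nat.choose_eq_zero_of_lt (by omega)]; exact Nat.zero_le _

theorem sum_range_two_mul_succ {M : Type*} [AddCommMonoid M] (g : ℕ → M) (n : ℕ) :
    ∑ k ∈ Finset.range (2 * n + 1), g k =
      ∑ j ∈ Finset.range (n + 1), g (2 * j) + ∑ j ∈ Finset.range n, g (2 * j + 1) := by
  induction n with
  | zero => simp
  | succ n ih =>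
    rw [show 2 * (n + 1) + 1 = 2 * n + 1 + 1 + 1 by ring, Finset.sum_range_succ,
      Finset.sum_range_succ, ih, Finset.sum_range_succ _ (n + 1),
      Finset.sum_range_succ (fun j => g (2 * j + 1)) n,
      show 2 * (n + 1) = 2 * n + 1 + 1 by ring]
    abel

/-- A scalar Bonami-type two-point inequality. -/
theorem add_pow_add_sub_pow_le (r : ℕ) (hr : 1 ≤ r) (a b : ℝ) :
    (a + b) ^ (2 * r) + (a - b) ^ (2 * r) ≤ 2 * (a ^ 2 + (2 * r - 1) * b ^ 2) ^ r := by
  have h : (a + b) ^ (2 * r) + (a - b) ^ (2 * r) =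
      2 * ∑ j ∈ Finset.range (r + 1),
        (b ^ 2) ^ j * (a ^ 2) ^ (r - j) * ((2 * r).choose (2 * j) : ℝ) := by
    -- The odd powers of `b` cancel between the two expansions and the even ones double.
    rw [add_comm a b, show a - b = -b + a by ring, add_pow, add_pow,
      sum_range_two_mul_succ, sum_range_two_mul_succ]
    have h1 : ∀ j, (-b) ^ (2 * j) = b ^ (2 * j) := fun j => by
      rw [pow_mul, pow_mul, neg_sq]
    have h2 : ∀ j, (-b) ^ (2 * j + 1) = - b ^ (2 * j + 1) := fun j => by
      rw [pow_succ, h1, pow_succ]; ring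
    simp only [h1, h2, neg_mul, Finset.sum_neg_distrib]
    have h3 : ∀ j ∈ Finset.range (r + 1),
        b ^ (2 * j) * a ^ (2 * r - 2 * j) * ((2 * r).choose (2 * j) : ℝ) =
        (b ^ 2) ^ j * (a ^ 2) ^ (r - j) * ((2 * r).choose (2 * j) : ℝ) := fun j _ => by
      rw [← pow_mul, ← pow_mul, Nat.mul_sub]
    rw [Finset.sum_congr rfl h3]; ring
  rw [h, add_comm (a ^ 2), add_pow]
  refine mul_le_mul_of_nonneg_left (Finset.sum_le_sum fun j _ => ?_) zero_le_two
  rw [mul_pow]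
  have hc : ((2 * r).choose (2 * j) : ℝ) ≤ (r.choose j : ℝ) * (2 * r - 1) ^ j := by
    have := choose_two_mul_le r j
    have h2 : (((2 * r - 1 : ℕ)) : ℝ) = 2 * r - 1 := by
      rw [Nat.cast_sub (by omega)]; push_cast; ring
    rw [← h2]; exact_mod_cast this
  calc (b ^ 2) ^ j * (a ^ 2) ^ (r - j) * ((2 * r).choose (2 * j) : ℝ)
      ≤ (b ^ 2) ^ j * (a ^ 2) ^ (r - j) * ((r.choose j : ℝ) * (2 * r - 1) ^ j) := by gcongr
    _ = _ := by ring

/-- The norm `‖v‖_{2r}`, as a norm on an `L^p`-space. -/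
noncomputable def evenNorm {d : ℕ} (r : ℕ) (v : Vec d) : ℝ :=
  ‖(WithLp.toLp ((2 * r : ℕ) : ℝ≥0∞) (WithLp.ofLp v) : PiLp ((2 * r : ℕ) : ℝ≥0∞) fun _ => ℝ)‖

theorem evenNorm_nonneg {d : ℕ} {r : ℕ} (v : Vec d) (hr : 1 ≤ r) : 0 ≤ evenNorm r v := by
  have : Fact ((1 : ℝ≥0∞) ≤ ((2 * r : ℕ) : ℝ≥0∞)) := ⟨by exact_mod_cast (by omega : 1 ≤ 2 * r)⟩
  exact norm_nonneg _

theorem evenNorm_sq_pow {d : ℕ} {r : ℕ} (hr : 1 ≤ r) (v : Vec d) :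
    (evenNorm r v ^ 2) ^ r = ∑ i, v i ^ (2 * r) := by
  have hp : 0 < ((2 * r : ℕ) : ℝ≥0∞).toReal := by
    rw [ENNReal.toReal_natCast]; exact_mod_cast (by omega : 0 < 2 * r)
  rw [← pow_mul, evenNorm, PiLp.norm_eq_sum hp, ENNReal.toReal_natCast, ← Real.rpow_natCast,
    ← Real.rpow_mul (by positivity), one_div, inv_mul_cancel₀ (by
      exact_mod_cast (by omega : 2 * r ≠ 0)), Real.rpow_one]
  refine Finset.sum_congr rfl fun i _ => ?_
  rw [Real.rpow_natCast, Real.norm_eq_abs, pow_mul, pow_mul, sq_abs]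

theorem evenNorm_convexOn {d : ℕ} {r : ℕ} (hr : 1 ≤ r) :
    ConvexOn ℝ Set.univ (fun v : Vec d => evenNorm r v) := by
  have : Fact ((1 : ℝ≥0∞) ≤ ((2 * r : ℕ) : ℝ≥0∞)) := ⟨by exact_mod_cast (by omega : 1 ≤ 2 * r)⟩
  refine ⟨convex_univ, fun x _ y _ a b ha hb _ => ?_⟩
  simp only [evenNorm, WithLp.ofLp_add, WithLp.ofLp_smul, WithLp.toLp_add, WithLp.toLp_smul]
  refine (norm_add_le _ _).trans ?_
  rw [norm_smul, norm_smul, Real.norm_of_nonneg ha, Real.norm_of_nonneg hb, smul_eq_mul,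
    smul_eq_mul]

theorem evenNorm_continuous {d : ℕ} {r : ℕ} (hr : 1 ≤ r) :
    Continuous (fun v : Vec d => evenNorm r v) := by
  have : Fact ((1 : ℝ≥0∞) ≤ ((2 * r : ℕ) : ℝ≥0∞)) := ⟨by exact_mod_cast (by omega : 1 ≤ 2 * r)⟩
  exact ((PiLp.continuous_toLp _ _).comp (PiLp.continuous_ofLp _ _)).norm

/-- The scalar inequality is applied in each coordinate. The power mean inequality merges the two
`r`-th powers on the left, and Minkowski in `ℓ^r` for the vectors `(x i ^ 2)` and `((2r-1) y i ^ 2)`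
splits the right-hand side. -/
theorem evenNorm_two_point {d : ℕ} {r : ℕ} (hr : 1 ≤ r) (x y : Vec d) :
    evenNorm r (x + y) ^ 2 + evenNorm r (x - y) ^ 2 ≤
      2 * evenNorm r x ^ 2 + 2 * ((2 * r - 1) * evenNorm r y ^ 2) := by
  have hr1 : (1 : ℝ) ≤ r := by exact_mod_cast hr
  have hc : (0 : ℝ) ≤ 2 * r - 1 := by linarith
  have hrr : r ≠ 0 := by omega
  set M := evenNorm r x ^ 2 + (2 * r - 1) * evenNorm r y ^ 2 with hM
  have hM0 : 0 ≤ M := by positivity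
  have mink : ∑ i, (x i ^ 2 + (2 * r - 1) * y i ^ 2) ^ r ≤ M ^ r := by
    have h := Real.Lp_add_le (Finset.univ) (fun i => x i ^ 2) (fun i => (2 * r - 1) * y i ^ 2) hr1
    have ex : (∑ i, |x i ^ 2| ^ (r : ℝ)) ^ (1 / (r : ℝ)) = evenNorm r x ^ 2 := by
      have : ∑ i, |x i ^ 2| ^ (r : ℝ) = (evenNorm r x ^ 2) ^ r := by
        rw [evenNorm_sq_pow hr]
        refine Finset.sum_congr rfl fun i _ => ?_
        rw [Real.rpow_natCast, abs_of_nonneg (by positivity), pow_mul]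
      rw [this, one_div, Real.pow_rpow_inv_natCast (by positivity) hrr]
    have ey : (∑ i, |(2 * r - 1) * y i ^ 2| ^ (r : ℝ)) ^ (1 / (r : ℝ)) =
        (2 * r - 1) * evenNorm r y ^ 2 := by
      have : ∑ i, |(2 * r - 1) * y i ^ 2| ^ (r : ℝ) = ((2 * r - 1) * evenNorm r y ^ 2) ^ r := by
        rw [mul_pow, evenNorm_sq_pow hr, Finset.mul_sum]
        refine Finset.sum_congr rfl fun i _ => ?_
        rw [Real.rpow_natCast, abs_of_nonneg (by positivity), mul_pow, pow_mul]
      rw [this, one_div, Real.pow_rpow_inv_natCast (by positivity) hrr]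
    rw [ex, ey, ← hM] at h
    have e : ∑ i, |x i ^ 2 + (2 * r - 1) * y i ^ 2| ^ (r : ℝ) =
        ∑ i, (x i ^ 2 + (2 * r - 1) * y i ^ 2) ^ r := by
      refine Finset.sum_congr rfl fun i _ => ?_
      rw [Real.rpow_natCast, abs_of_nonneg (by positivity)]
    rw [e] at h
    have h0 : 0 ≤ ∑ i, (x i ^ 2 + (2 * r - 1) * y i ^ 2) ^ r :=
      Finset.sum_nonneg fun i _ => by positivity
    have := pow_le_pow_left₀ (by positivity) h r
    rwa [one_div, Real.rpow_inv_natCast_pow h0 hrr] at this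
  have key : (evenNorm r (x + y) ^ 2 + evenNorm r (x - y) ^ 2) ^ r ≤ (2 * M) ^ r := by
    refine (add_pow_le (by positivity) (by positivity) r).trans ?_
    rw [evenNorm_sq_pow hr, evenNorm_sq_pow hr, ← Finset.sum_add_distrib]
    calc (2 : ℝ) ^ (r - 1) * ∑ i, ((x + y) i ^ (2 * r) + (x - y) i ^ (2 * r))
        ≤ 2 ^ (r - 1) * ∑ i, 2 * (x i ^ 2 + (2 * r - 1) * y i ^ 2) ^ r := by
          gcongr with i
          exact add_pow_add_sub_pow_le r hr (x i) (y i)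
      _ ≤ 2 ^ (r - 1) * (2 * M ^ r) := by rw [← Finset.mul_sum]; gcongr
      _ = (2 * M) ^ r := by
          rw [mul_pow, ← mul_assoc, ← pow_succ, Nat.sub_add_cancel hr]
  have := le_of_pow_le_pow_left₀ hrr (by positivity) key
  rw [hM] at this; linarith

/-! ### The sup norm and a smooth potential dominating its square -/

theorem abs_le_linfNorm {d : ℕ} (v : Vec d) (i : Fin d) : |v i| ≤ linfNorm v :=
  norm_le_pi_norm (WithLp.ofLp v) i

theorem linfNorm_nonneg {d : ℕ} (v : Vec d) : 0 ≤ linfNorm v := norm_nonneg _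

theorem linfNorm_le_iff {d : ℕ} (v : Vec d) {a : ℝ} (ha : 0 ≤ a) :
    linfNorm v ≤ a ↔ ∀ i, |v i| ≤ a := pi_norm_le_iff_of_nonneg ha

theorem linfNorm_continuous {d : ℕ} : Continuous (fun v : Vec d => linfNorm v) :=
  (PiLp.continuous_ofLp _ _).norm

theorem linfNorm_add_le {d : ℕ} (v w : Vec d) : linfNorm (v + w) ≤ linfNorm v + linfNorm w :=
  norm_add_le (WithLp.ofLp v) (WithLp.ofLp w)

theorem linfNorm_smul {d : ℕ} (c : ℝ) (v : Vec d) : linfNorm (c • v) = |c| * linfNorm v :=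
  norm_smul c (WithLp.ofLp v)

theorem linfNorm_neg {d : ℕ} (v : Vec d) : linfNorm (-v) = linfNorm v :=
  norm_neg (WithLp.ofLp v)

theorem linfNorm_sub_le {d : ℕ} (v w : Vec d) : linfNorm (v - w) ≤ linfNorm v + linfNorm w :=
  norm_sub_le (WithLp.ofLp v) (WithLp.ofLp w)

theorem linfNorm_sq_convexOn {d : ℕ} :
    ConvexOn ℝ Set.univ (fun v : Vec d => linfNorm v ^ 2) := by
  have h : ConvexOn ℝ Set.univ (fun v : Vec d => linfNorm v) := by
    refine ⟨convex_univ, fun x _ y _ a b ha hb _ => ?_⟩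
    refine (linfNorm_add_le _ _).trans ?_
    rw [linfNorm_smul, linfNorm_smul, abs_of_nonneg ha, abs_of_nonneg hb, smul_eq_mul,
      smul_eq_mul]
  exact h.pow (fun x _ => linfNorm_nonneg x) 2

theorem linfNorm_sq_le_evenNorm_sq {d : ℕ} {r : ℕ} (hr : 1 ≤ r) (v : Vec d) :
    linfNorm v ^ 2 ≤ evenNorm r v ^ 2 := by
  have h0 := evenNorm_nonneg v hr
  refine pow_le_pow_left₀ (linfNorm_nonneg v) ((linfNorm_le_iff v h0).2 fun i => ?_) 2
  refine abs_le_of_sq_le_sq ?_ h0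
  refine le_of_pow_le_pow_left₀ (by omega : r ≠ 0) (by positivity) ?_
  rw [evenNorm_sq_pow hr, ← pow_mul]
  exact Finset.single_le_sum (f := fun i => v i ^ (2 * r))
    (fun i _ => (even_two_mul r).pow_nonneg _) (Finset.mem_univ i)

/-- Bounding a sum of `d` terms by its largest term costs a factor `d ≤ e^r`, which becomes `e`
after taking the `r`-th root. -/
theorem evenNorm_sq_le {d : ℕ} (hd : 1 ≤ d) {r : ℕ} (hr : 1 ≤ r) (hdr : Real.log d ≤ r)
    (v : Vec d) : evenNorm r v ^ 2 ≤ Real.exp 1 * linfNorm v ^ 2 := by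
  refine le_of_pow_le_pow_left₀ (by omega : r ≠ 0)
    (mul_nonneg (Real.exp_pos _).le (sq_nonneg _)) ?_
  have h1 : (d : ℝ) ≤ Real.exp 1 ^ r := by
    rw [← Real.exp_nat_mul, mul_one]
    exact (Real.log_le_iff_le_exp (by exact_mod_cast hd)).1 hdr
  rw [evenNorm_sq_pow hr, mul_pow, ← pow_mul]
  calc ∑ i, v i ^ (2 * r) ≤ ∑ _i : Fin d, linfNorm v ^ (2 * r) := by
        refine Finset.sum_le_sum fun i _ => ?_
        rw [← (even_two_mul r).pow_abs]
        exact pow_le_pow_left₀ (abs_nonneg _) (abs_le_linfNorm v i) _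
    _ = d * linfNorm v ^ (2 * r) := by simp
    _ ≤ _ := mul_le_mul_of_nonneg_right h1 (pow_nonneg (linfNorm_nonneg v) _)

/-- A convex potential dominating `‖·‖_∞²` that is 2-uniformly smooth with constant `B`
with respect to `‖·‖_∞`. -/
structure IsSmoothPotential {d : ℕ} (V : Vec d → ℝ) (B : ℝ) : Prop where
  convexOn : ConvexOn ℝ Set.univ V
  continuous : Continuous V
  map_zero : V 0 = 0
  linf_le : ∀ v, linfNorm v ^ 2 ≤ V v
  two_point : ∀ v w, V (v + w) + V (v - w) ≤ 2 * V v + 2 * (B * linfNorm w ^ 2)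

theorem IsSmoothPotential.nonneg {d : ℕ} {V : Vec d → ℝ} {B : ℝ} (h : IsSmoothPotential V B)
    (v : Vec d) : 0 ≤ V v := (sq_nonneg _).trans (h.linf_le v)

/-- The exponent `r = ⌈log d⌉` is large enough for the comparison factor to be `e` and small enough
that `2r - 1 ≤ 2 log d + 1`. -/
theorem exists_isSmoothPotential {d : ℕ} (hd : 2 ≤ d) :
    ∃ V : Vec d → ℝ, IsSmoothPotential V ((2 * Real.log d + 1) * Real.exp 1) := by
  have hlog : 0 < Real.log d := Real.log_pos (by exact_mod_cast (by omega : 1 < d))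
  set r := ⌈Real.log d⌉₊ with hr_def
  have hr : 1 ≤ r := Nat.one_le_iff_ne_zero.2 (Nat.ceil_pos.2 hlog).ne'
  have hr1 : (1 : ℝ) ≤ r := by exact_mod_cast hr
  have hlt : (r : ℝ) < Real.log d + 1 := Nat.ceil_lt_add_one hlog.le
  refine ⟨fun v => evenNorm r v ^ 2, (evenNorm_convexOn hr).pow
    (fun v _ => evenNorm_nonneg v hr) 2, (evenNorm_continuous hr).pow 2, ?_,
    linfNorm_sq_le_evenNorm_sq hr, fun v w => (evenNorm_two_point hr v w).trans ?_⟩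
  · have := evenNorm_sq_le (by omega) hr (Nat.le_ceil _) (0 : Vec d)
    have h0 : linfNorm (0 : Vec d) = 0 := norm_zero
    rw [h0] at this
    exact le_antisymm (by simpa using this) (sq_nonneg _)
  · gcongr 2 * evenNorm r v ^ 2 + 2 * ?_
    calc (2 * (r : ℝ) - 1) * evenNorm r w ^ 2
        ≤ (2 * Real.log d + 1) * (Real.exp 1 * linfNorm w ^ 2) :=
          mul_le_mul (by linarith) (evenNorm_sq_le (by omega) hr (Nat.le_ceil _) w)
            (sq_nonneg _) (by linarith)
      _ = _ := by ring

/-! ### The `ℓ¹` norm and duality -/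

theorem l1Norm_nonneg {d : ℕ} (v : Vec d) : 0 ≤ l1Norm v :=
  Finset.sum_nonneg fun _ _ => abs_nonneg _

theorem l1Norm_zero {d : ℕ} : l1Norm (0 : Vec d) = 0 := by simp [l1Norm]

theorem l1Norm_continuous {d : ℕ} : Continuous (fun v : Vec d => l1Norm v) := by
  unfold l1Norm; fun_prop

theorem l1Norm_add_le {d : ℕ} (v w : Vec d) : l1Norm (v + w) ≤ l1Norm v + l1Norm w := by
  unfold l1Norm; rw [← Finset.sum_add_distrib]
  exact Finset.sum_le_sum fun i _ => abs_add_le _ _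

theorem l1Norm_smul {d : ℕ} (c : ℝ) (v : Vec d) : l1Norm (c • v) = |c| * l1Norm v := by
  simp [l1Norm, Finset.mul_sum, abs_mul]

theorem l1Norm_single {d : ℕ} (i : Fin d) (t : ℝ) :
    l1Norm (EuclideanSpace.single i t) = |t| := by
  unfold l1Norm
  rw [Finset.sum_eq_single i] <;> simp +contextual

theorem l1Norm_convexOn {d : ℕ} : ConvexOn ℝ Set.univ (fun v : Vec d => l1Norm v) := by
  refine ⟨convex_univ, fun x _ y _ a b ha hb _ => ?_⟩
  refine (l1Norm_add_le _ _).trans ?_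
  rw [l1Norm_smul, l1Norm_smul, abs_of_nonneg ha, abs_of_nonneg hb, smul_eq_mul, smul_eq_mul]

theorem inner_le_linfNorm_mul_l1Norm {d : ℕ} (v w : Vec d) :
    inner ℝ v w ≤ linfNorm v * l1Norm w := by
  rw [PiLp.inner_apply, l1Norm, Finset.mul_sum]
  refine Finset.sum_le_sum fun i _ => ?_
  calc inner ℝ (v i) (w i) = v i * w i := by simp [mul_comm]
    _ ≤ |v i| * |w i| := by rw [← abs_mul]; exact le_abs_self _
    _ ≤ _ := by gcongr; exact abs_le_linfNorm v i

theorem linfNorm_le_l1Norm {d : ℕ} (v : Vec d) : linfNorm v ≤ l1Norm v :=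
  (linfNorm_le_iff v (l1Norm_nonneg v)).2 fun i =>
    Finset.single_le_sum (f := fun i => |v i|) (fun _ _ => abs_nonneg _) (Finset.mem_univ i)

theorem l1Norm_le_norm {d : ℕ} (v : Vec d) : l1Norm v ≤ d * ‖v‖ := by
  calc l1Norm v ≤ ∑ _i : Fin d, ‖v‖ := Finset.sum_le_sum fun i _ => PiLp.norm_apply_le v i
    _ = d * ‖v‖ := by simp

/-- The factor `d` is crude, but it enters only the continuity of the proximal map, never a rate. -/
theorem norm_le_linfNorm {d : ℕ} (v : Vec d) : ‖v‖ ≤ d * linfNorm v := by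
  have h : l1Norm v ≤ d * linfNorm v := by
    calc l1Norm v ≤ ∑ _i : Fin d, linfNorm v := Finset.sum_le_sum fun i _ => abs_le_linfNorm v i
      _ = d * linfNorm v := by simp
  rcases eq_or_lt_of_le (norm_nonneg v) with h0 | h0
  · rw [← h0]; exact mul_nonneg (Nat.cast_nonneg _) (linfNorm_nonneg v)
  · have h1 := inner_le_linfNorm_mul_l1Norm v v
    rw [real_inner_self_eq_norm_sq] at h1
    have h2 : linfNorm v ≤ ‖v‖ := (linfNorm_le_iff v h0.le).2 fun i => PiLp.norm_apply_le v i
    have h3 := l1Norm_nonneg v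
    nlinarith

/-! ### Optimality, stability and measurability of the proximal step -/

/-- The sum rule for a continuous convex function and a linear function on a convex set. -/
theorem exists_subgradient {E : Type*} [NormedAddCommGroup E] [InnerProductSpace ℝ E]
    [CompleteSpace E] {X : Set E} (hX : Convex ℝ X) {φ : E → ℝ} (hφ : ConvexOn ℝ Set.univ φ)
    (hc : Continuous φ) {y c : E} (hy : y ∈ X)
    (hmin : ∀ u ∈ X, φ y ≤ φ u + inner ℝ c (u - y)) :
    ∃ s : E, (∀ u, φ y + inner ℝ s (u - y) ≤ φ u) ∧ ∀ u ∈ X, 0 ≤ inner ℝ (c + s) (u - y) := by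
  -- The strict epigraph of `φ` is open and convex, and by minimality it misses the part over `X`
  -- below an affine function; a separating hyperplane yields the subgradient.
  have hA : Convex ℝ {p : E × ℝ | φ p.1 < p.2} := by
    have := hφ.convex_strict_epigraph
    simpa using this
  have hAo : IsOpen {p : E × ℝ | φ p.1 < p.2} :=
    isOpen_lt (hc.comp continuous_fst) continuous_snd
  have hB : Convex ℝ {p : E × ℝ | p.1 ∈ X ∧ p.2 ≤ φ y - inner ℝ c (p.1 - y)} := by
    rintro ⟨u, s⟩ ⟨hu, hs⟩ ⟨w, t⟩ ⟨hw, ht⟩ a b ha hb hab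
    refine ⟨hX hu hw ha hb hab, ?_⟩
    simp only at hs ht
    have e : a • u + b • w - y = a • (u - y) + b • (w - y) := by
      have : y = (a + b) • y := by rw [hab, one_smul]
      nth_rewrite 1 [this]; module
    simp only [Prod.smul_mk, Prod.mk_add_mk, smul_eq_mul, e, inner_add_right, inner_smul_right]
    have hφy : φ y = a * φ y + b * φ y := by rw [← add_mul, hab, one_mul]
    nlinarith [mul_le_mul_of_nonneg_left hs ha, mul_le_mul_of_nonneg_left ht hb]
  have hdisj : Disjoint {p : E × ℝ | φ p.1 < p.2}
      {p : E × ℝ | p.1 ∈ X ∧ p.2 ≤ φ y - inner ℝ c (p.1 - y)} := by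
    rw [Set.disjoint_left]
    rintro ⟨u, t⟩ h1 ⟨h2, h3⟩
    have := hmin u h2
    simp only [Set.mem_ofPred_eq] at h1 h3
    linarith
  obtain ⟨g, γ, hgA, hgB⟩ := geometric_hahn_banach_open hA hAo hB hdisj
  set w := (InnerProductSpace.toDual ℝ E).symm (g.comp (ContinuousLinearMap.inl ℝ E ℝ)) with hw
  set α := g (0, 1) with hα
  have hg : ∀ u t, g (u, t) = inner ℝ w u + t * α := by
    intro u t
    have h1 : inner ℝ w u = g (u, 0) := by
      rw [hw, InnerProductSpace.toDual_symm_apply]; simp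
    have h2 : t * α = g (0, t) := by
      rw [hα, ← smul_eq_mul, ← map_smul]; simp
    rw [h1, h2, ← map_add]; simp
  -- The hyperplane is not vertical: the two sets contain points lying over the same `y`.
  have hα0 : α < 0 := by
    have h1 := hgA (y, φ y + 1) (by simp)
    have h2 := hgB (y, φ y) (by simp [hy])
    rw [hg] at h1 h2; linarith
  have hA' : ∀ u, inner ℝ w u + φ u * α ≤ γ := by
    intro u
    refine le_of_forall_pos_lt_add fun δ hδ => ?_
    have h1 := hgA (u, φ u + δ / (-α)) (by
      simp only [Set.mem_ofPred_eq, lt_add_iff_pos_right]; exact div_pos hδ (by linarith))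
    rw [hg, add_mul] at h1
    have : δ / (-α) * α = -δ := by rw [div_neg, neg_mul, div_mul_cancel₀ _ hα0.ne]
    linarith
  refine ⟨(-α)⁻¹ • w, fun u => ?_, fun u hu => ?_⟩
  · have h1 := hA' u
    have h2 := hgB (y, φ y) (by simp [hy])
    rw [hg] at h2
    rw [real_inner_smul_left, inner_sub_right]
    have h3 : inner ℝ w u - inner ℝ w y ≤ (φ u - φ y) * (-α) := by linarith
    have : (-α)⁻¹ * (inner ℝ w u - inner ℝ w y) ≤ φ u - φ y := by
      rw [inv_mul_le_iff₀ (by linarith)]; linarith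
    linarith
  · have h1 := hA' y
    have h2 := hgB (u, φ y - inner ℝ c (u - y)) ⟨hu, le_rfl⟩
    rw [hg] at h2
    rw [inner_add_left, real_inner_smul_left]
    have h3 : 0 ≤ inner ℝ w (u - y) + (-α) * inner ℝ c (u - y) := by
      rw [inner_sub_right w]; linarith
    have : inner ℝ c (u - y) + (-α)⁻¹ * inner ℝ w (u - y) =
        (-α)⁻¹ * (inner ℝ w (u - y) + (-α) * inner ℝ c (u - y)) := by
      have : α ≠ 0 := hα0.ne
      field_simp; ring
    rw [this]
    exact mul_nonneg (inv_nonneg.2 (by linarith)) h3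

theorem prox1_convexOn {d : ℕ} {ρ : ℝ} (hρ : 0 ≤ ρ) :
    ConvexOn ℝ Set.univ (prox1 ρ : Vec d → ℝ) :=
  (l1Norm_convexOn.pow (fun v _ => l1Norm_nonneg v) 2).smul (by positivity : 0 ≤ ρ / 2)

theorem prox1_continuous {d : ℕ} (ρ : ℝ) : Continuous (prox1 ρ : Vec d → ℝ) :=
  continuous_const.mul (l1Norm_continuous.pow 2)

/-- First-order optimality of the proximal projection in variational form. -/
theorem IsProxProj.variational {d : ℕ} {X : Set (Vec d)} (hX : Convex ℝ X) {φ : Vec d → ℝ}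
    (hφ : ConvexOn ℝ Set.univ φ) {a v y : Vec d} (h : IsProxProj X φ a v y) {u : Vec d}
    (hu : u ∈ X) : φ (y - a) ≤ φ (u - a) + inner ℝ (y - v) (u - y) := by
  -- The minimiser is compared with a point of the segment towards `u`; after division by `t` only a
  -- term linear in `t` is left, which vanishes as `t → 0`.
  have key : ∀ t : ℝ, 0 < t → t ≤ 1 →
      φ (y - a) ≤ φ (u - a) + inner ℝ (y - v) (u - y) + t * (1 / 2 * ‖u - y‖ ^ 2) := by
    intro t ht0 ht1
    have hmem : (1 - t) • y + t • u ∈ X := hX h.1 hu (by linarith) ht0.le (by ring)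
    have h1 := h.2 hmem
    simp only [Set.mem_ofPred_eq] at h1
    have e1 : (1 - t) • y + t • u - v = (y - v) + t • (u - y) := by module
    have e2 : (1 - t) • y + t • u - a = (1 - t) • (y - a) + t • (u - a) := by module
    have h2 := hφ.2 (Set.mem_univ (y - a)) (Set.mem_univ (u - a)) (by linarith : 0 ≤ 1 - t)
      ht0.le (by ring)
    rw [e1, e2, norm_add_sq_real, real_inner_smul_right, norm_smul, Real.norm_of_nonneg ht0.le]
      at h1
    simp only [smul_eq_mul] at h2
    refine le_of_mul_le_mul_left ?_ ht0
    nlinarith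
  refine le_of_forall_pos_le_add fun δ hδ => ?_
  set N := 1 / 2 * ‖u - y‖ ^ 2
  have hN : 0 ≤ N := by positivity
  have h1 := key (min 1 (δ / (N + 1))) (lt_min one_pos (by positivity)) (min_le_left _ _)
  have h2 : min 1 (δ / (N + 1)) * N ≤ δ := by
    calc min 1 (δ / (N + 1)) * N ≤ δ / (N + 1) * (N + 1) :=
          mul_le_mul (min_le_right _ _) (by linarith) hN (by positivity)
      _ = δ := by field_simp
  linarith

/-- First-order optimality of the proximal step with a multiplier in the subdifferential of
`(ρ/2) ‖·‖₁²`. -/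
theorem IsProxProj.exists_multiplier {d : ℕ} {X : Set (Vec d)} (hX : Convex ℝ X) {ρ : ℝ}
    (hρ : 0 ≤ ρ) {a v y : Vec d} (h : IsProxProj X (prox1 ρ) a v y) :
    ∃ s : Vec d, (∀ u, prox1 ρ (y - a) + inner ℝ s (u - y) ≤ prox1 ρ (u - a)) ∧
      (∀ u ∈ X, 0 ≤ inner ℝ (y - v + s) (u - y)) ∧ linfNorm s ≤ ρ * l1Norm (y - a) := by
  have hc : ConvexOn ℝ Set.univ (fun u : Vec d => prox1 ρ (u - a)) := by
    have := (prox1_convexOn (d := d) hρ).translate_left (-a)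
    simpa [Function.comp_def, sub_eq_add_neg] using this
  obtain ⟨s, hs1, hs2⟩ := exists_subgradient hX hc
    ((prox1_continuous ρ).comp (continuous_id.sub continuous_const)) (c := y - v) h.1
    (fun u hu => h.variational hX (prox1_convexOn hρ) hu)
  refine ⟨s, hs1, hs2, (linfNorm_le_iff s (mul_nonneg hρ (l1Norm_nonneg _))).2 fun i => ?_⟩
  -- The subgradient inequality is tested at `y + t e_i`; small `t` of both signs bounds `|s i|`,
  -- the quadratic term being negligible.
  have key : ∀ t : ℝ, t * s i ≤ ρ * l1Norm (y - a) * |t| + ρ / 2 * t ^ 2 := by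
    intro t
    have h1 := hs1 (y + EuclideanSpace.single i t)
    have e : y + EuclideanSpace.single i t - a = (y - a) + EuclideanSpace.single i t := by abel
    have h2 := l1Norm_add_le (y - a) (EuclideanSpace.single i t)
    rw [l1Norm_single] at h2
    have h3 := pow_le_pow_left₀ (l1Norm_nonneg _) h2 2
    rw [e, add_sub_cancel_left, EuclideanSpace.inner_single_right] at h1
    simp only [prox1, conj_trivial] at h1
    have h4 := mul_le_mul_of_nonneg_left h3 (by positivity : 0 ≤ ρ / 2)
    have h5 : |t| ^ 2 = t ^ 2 := sq_abs t
    nlinarith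
  refine le_of_forall_pos_le_add fun δ hδ => ?_
  have hτ : 0 < δ / (ρ + 1) := by positivity
  have hτ2 : ρ / 2 * (δ / (ρ + 1)) ≤ δ := by
    rw [← mul_div_assoc, div_le_iff₀ (by positivity)]; nlinarith
  set τ := δ / (ρ + 1)
  rw [abs_le']
  constructor
  · have h1 := key τ
    rw [abs_of_pos hτ] at h1
    refine le_of_mul_le_mul_left ?_ hτ
    nlinarith
  · have h1 := key (-τ)
    rw [abs_neg, abs_of_pos hτ] at h1
    refine le_of_mul_le_mul_left ?_ hτ
    nlinarith

/-- Testing the variational inequality at the centre `a` and dropping the nonnegative proximal term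
leaves `‖y - a‖² ≤ ⟨v - a, y - a⟩`. -/
theorem IsProxProj.norm_sub_le {d : ℕ} {X : Set (Vec d)} (hX : Convex ℝ X) {ρ : ℝ}
    (hρ : 0 ≤ ρ) {a v y : Vec d} (ha : a ∈ X) (h : IsProxProj X (prox1 ρ) a v y) :
    ‖y - a‖ ≤ ‖v - a‖ := by
  have h1 := h.variational hX (prox1_convexOn hρ) ha
  have h2 : prox1 ρ (a - a) = 0 := by simp [prox1, l1Norm_zero]
  have h3 : 0 ≤ prox1 ρ (y - a) := by unfold prox1; positivity
  have h4 : inner ℝ (y - v) (a - y) = inner ℝ (v - a) (y - a) - ‖y - a‖ ^ 2 := by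
    rw [show y - v = (y - a) - (v - a) by abel, show a - y = -(y - a) by abel, inner_neg_right,
      inner_sub_left, real_inner_self_eq_norm_sq]; ring
  have h5 := real_inner_le_norm (v - a) (y - a)
  by_contra hlt
  push Not at hlt
  nlinarith [norm_nonneg (y - a), norm_nonneg (v - a)]

/-- Stability of the proximal step in the centre and in the projected point. -/
theorem IsProxProj.norm_sub_sq_le {d : ℕ} {X : Set (Vec d)} (hX : Convex ℝ X) {ρ : ℝ}
    (hρ : 0 ≤ ρ) {a v y a' v' y' : Vec d} (ha : a ∈ X) (ha' : a' ∈ X)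
    (h : IsProxProj X (prox1 ρ) a v y) (h' : IsProxProj X (prox1 ρ) a' v' y') :
    ‖y - y'‖ ^ 2 ≤ ‖v - v'‖ ^ 2 +
      2 * (d * (ρ * (d * ‖v - a‖)) + d * (ρ * (d * ‖v' - a'‖))) * ‖a - a'‖ := by
  have bound : ∀ {a v y s : Vec d}, a ∈ X → IsProxProj X (prox1 ρ) a v y →
      linfNorm s ≤ ρ * l1Norm (y - a) → ‖s‖ ≤ d * (ρ * (d * ‖v - a‖)) := by
    intro a v y s ha h hs
    refine (norm_le_linfNorm s).trans ?_
    gcongr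
    refine hs.trans ?_
    gcongr
    refine (l1Norm_le_norm _).trans ?_
    gcongr
    exact h.norm_sub_le hX hρ ha
  obtain ⟨s, hs, hn, hb⟩ := h.exists_multiplier hX hρ
  obtain ⟨s', hs', hn', hb'⟩ := h'.exists_multiplier hX hρ
  have b := bound ha h hb
  have b' := bound ha' h' hb'
  have h1 := hn y' h'.1
  have h2 := hn' y h.1
  -- Each multiplier is tested at the other step transported to its own centre, so that the proximal
  -- values cancel in the sum.
  have h3 := hs (a + (y' - a'))
  have h4 := hs' (a' + (y - a))
  rw [show a + (y' - a') - a = y' - a' by abel,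
    show a + (y' - a') - y = (y' - y) + (a - a') by abel, inner_add_right] at h3
  rw [show a' + (y - a) - a' = y - a by abel,
    show a' + (y - a) - y' = (y - y') - (a - a') by abel, inner_sub_right] at h4
  rw [inner_add_left] at h1 h2
  have e1 : inner ℝ (y - v) (y' - y) + inner ℝ (y' - v') (y - y') =
      inner ℝ (v - v') (y - y') - ‖y - y'‖ ^ 2 := by
    rw [show y' - y = -(y - y') by abel, inner_neg_right, ← real_inner_self_eq_norm_sq,
      ← sub_eq_zero, ← sub_eq_zero]
    simp only [inner_sub_left]; ring
  have i1 := real_inner_le_norm (v - v') (y - y')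
  have i2 := real_inner_le_norm (-s) (a - a')
  have i3 := real_inner_le_norm s' (a - a')
  rw [inner_neg_left, norm_neg] at i2
  have i4 := mul_le_mul_of_nonneg_right b (norm_nonneg (a - a'))
  have i5 := mul_le_mul_of_nonneg_right b' (norm_nonneg (a - a'))
  nlinarith [sq_nonneg (‖v - v'‖ - ‖y - y'‖)]

theorem IsProxProj.unique {d : ℕ} {X : Set (Vec d)} (hX : Convex ℝ X) {ρ : ℝ}
    (hρ : 0 ≤ ρ) {a v y y' : Vec d} (ha : a ∈ X)
    (h : IsProxProj X (prox1 ρ) a v y) (h' : IsProxProj X (prox1 ρ) a v y') : y = y' := by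
  have := h.norm_sub_sq_le hX hρ ha ha h'
  simp only [sub_self, norm_zero, mul_zero] at this
  have h0 : ‖y - y'‖ = 0 := by nlinarith [norm_nonneg (y - y')]
  exact sub_eq_zero.1 (norm_eq_zero.1 h0)

/-- The proximal step of measurable data is measurable. -/
theorem measurable_of_isProxProj {d : ℕ} {X : Set (Vec d)} (hX : Convex ℝ X) {ρ : ℝ}
    (hρ : 0 ≤ ρ) {S : Type*} {mS : MeasurableSpace S} {a v y : S → Vec d} (ha : Measurable a)
    (hv : Measurable v) (haX : ∀ ω, a ω ∈ X)
    (h : ∀ ω, IsProxProj X (prox1 ρ) (a ω) (v ω) (y ω)) : Measurable y := by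
  -- Restricting to the pairs for which a minimiser exists makes existence unnecessary; on `R` the
  -- proximal map is single-valued and continuous by the stability estimate.
  set R : Set (Vec d × Vec d) := {p | p.1 ∈ X ∧ ∃ y, IsProxProj X (prox1 ρ) p.1 p.2 y} with hR
  choose Φ hΦ using fun p : R => p.2.2
  have hcont : Continuous Φ := by
    rw [continuous_iff_continuousAt]
    intro p
    rw [ContinuousAt, tendsto_iff_norm_sub_tendsto_zero]
    have hb : ∀ q : R, ‖Φ q - Φ p‖ ≤ √(‖q.1.2 - p.1.2‖ ^ 2 +
      2 * (d * (ρ * (d * ‖q.1.2 - q.1.1‖)) + d * (ρ * (d * ‖p.1.2 - p.1.1‖))) *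
        ‖q.1.1 - p.1.1‖) := fun q =>
      Real.le_sqrt_of_sq_le ((hΦ q).norm_sub_sq_le hX hρ q.2.1 p.2.1 (hΦ p))
    refine squeeze_zero (fun _ => norm_nonneg _) hb ?_
    have hc : Continuous (fun q : R => √(‖q.1.2 - p.1.2‖ ^ 2 +
      2 * (d * (ρ * (d * ‖q.1.2 - q.1.1‖)) + d * (ρ * (d * ‖p.1.2 - p.1.1‖))) *
        ‖q.1.1 - p.1.1‖)) := by fun_prop
    have := hc.tendsto p
    simpa using this
  have hm : Measurable (fun ω => (⟨(a ω, v ω), haX ω, y ω, h ω⟩ : R)) :=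
    (ha.prodMk hv).subtype_mk
  have e : y = Φ ∘ fun ω => (⟨(a ω, v ω), haX ω, y ω, h ω⟩ : R) := by
    funext ω
    exact (h ω).unique hX hρ (haX ω) (hΦ ⟨(a ω, v ω), haX ω, y ω, h ω⟩)
  rw [e]
  exact hcont.measurable.comp hm

/-! ### One proximal step: descent and stationarity -/

/-- A mean-value form of the descent lemma on a convex set. -/
theorem le_add_of_gradient_lipschitz {d : ℕ} {X : Set (Vec d)} (hX : Convex ℝ X)
    {f : Vec d → ℝ} (hf : Differentiable ℝ f) {L : ℝ} (hL : 0 ≤ L)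
    (hlip : ∀ x ∈ X, ∀ y ∈ X, linfNorm (gradient f x - gradient f y) ≤ L * l1Norm (x - y))
    {x y : Vec d} (hx : x ∈ X) (hy : y ∈ X) :
    f y ≤ f x + inner ℝ (gradient f x) (y - x) + L * l1Norm (y - x) ^ 2 := by
  have hd : ∀ t : ℝ, HasDerivAt (fun t : ℝ => f (x + t • (y - x)))
      (inner ℝ (gradient f (x + t • (y - x))) (y - x)) t := by
    intro t
    have h1 : HasDerivAt (fun t : ℝ => x + t • (y - x)) (y - x) t := by
      simpa using ((hasDerivAt_id t).smul_const (y - x)).const_add x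
    have h2 := (hf (x + t • (y - x))).hasGradientAt.hasFDerivAt.comp_hasDerivAt t h1
    rwa [InnerProductSpace.toDual_apply_apply] at h2
  -- A single mean-value point replaces integration along the segment; this gives the constant `L`
  -- instead of `L/2`.
  obtain ⟨t, ht, he⟩ := exists_hasDerivAt_eq_slope (fun t : ℝ => f (x + t • (y - x)))
    (fun t => inner ℝ (gradient f (x + t • (y - x))) (y - x)) zero_lt_one
    (fun t _ => (hd t).continuousAt.continuousWithinAt) (fun t _ => hd t)
  simp only [one_smul, zero_smul, add_zero, sub_zero, div_one, add_sub_cancel] at he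
  have hmem : x + t • (y - x) ∈ X := hX.add_smul_sub_mem hx hy ⟨ht.1.le, ht.2.le⟩
  have h1 := hlip _ hmem _ hx
  rw [add_sub_cancel_left, l1Norm_smul, abs_of_pos ht.1] at h1
  have h2 := inner_le_linfNorm_mul_l1Norm (gradient f (x + t • (y - x)) - gradient f x) (y - x)
  rw [inner_sub_left] at h2
  have h0 := l1Norm_nonneg (y - x)
  have h3 : linfNorm (gradient f (x + t • (y - x)) - gradient f x) ≤ L * l1Norm (y - x) := by
    refine h1.trans (mul_le_mul_of_nonneg_left ?_ hL)
    nlinarith [ht.2]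
  have h4 := mul_le_mul_of_nonneg_right h3 h0
  nlinarith

/-- At infeasible points the indicator is `⊤`; at feasible ones the normal vector `w` has
nonpositive pairing, and differentiability of `f` supplies the error `δ‖u - y‖`. -/
theorem add_mem_subdifferential {d : ℕ} {X : Set (Vec d)} {f : Vec d → ℝ} {y w : Vec d}
    (hf : DifferentiableAt ℝ f y) (hy : y ∈ X) (hw : ∀ u ∈ X, inner ℝ w (u - y) ≤ 0) :
    gradient f y + w ∈ subdifferential (fun u => (f u : EReal) + indicatorFn X u) y := by
  have hyv : (f y : EReal) + indicatorFn X y = (f y : EReal) := by simp [indicatorFn, hy]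
  refine ⟨by simp [hyv], by simp [hyv], fun δ hδ => ?_⟩
  have h1 := (hasGradientAt_iff_isLittleO.1 hf.hasGradientAt).def hδ
  filter_upwards [h1] with u hu
  by_cases hX : u ∈ X
  · have huv : (f u : EReal) + indicatorFn X u = (f u : EReal) := by simp [indicatorFn, hX]
    rw [hyv, huv, ← EReal.coe_add, EReal.coe_le_coe_iff, inner_add_left]
    have h2 := (abs_le.1 hu).1
    have h3 := hw u hX
    linarith
  · simp [indicatorFn, hX]

/-- The stationarity residual after a proximal step. -/
theorem stationarityResidual_le {d : ℕ} {X : Set (Vec d)} (hX : Convex ℝ X)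
    {f : Vec d → ℝ} (hf : Differentiable ℝ f) {L ρ : ℝ} (hL : 0 < L) (hρ : 0 ≤ ρ)
    (hlip : ∀ x ∈ X, ∀ y ∈ X, linfNorm (gradient f x - gradient f y) ≤ L * l1Norm (x - y))
    {a G y : Vec d} (ha : a ∈ X) (h : IsProxProj X (prox1 ρ) a (a - (1 / L) • G) y) :
    stationarityResidual f X y ≤
      ENNReal.ofReal ((ρ + 2) * (L * l1Norm (y - a)) + linfNorm (G - gradient f a)) := by
  obtain ⟨s, -, hn, hb⟩ := h.exists_multiplier hX hρ
  -- Minus `L` times the optimality vector is normal to `X` at `y`. Adding it to `∇f(y)` turns `G`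
  -- into the error `G - ∇f(a)`, leaving terms of size `L`, `L` and `Lρ` times `‖y - a‖₁`.
  set w := (-L) • (y - (a - (1 / L) • G) + s) with hw
  have hmem := add_mem_subdifferential (w := w) (hf y) h.1 (fun u hu => by
    rw [hw, real_inner_smul_left]
    have := mul_nonneg hL.le (hn u hu); linarith)
  refine (iInf₂_le _ hmem).trans (ENNReal.ofReal_le_ofReal ?_)
  have e : gradient f y + w = (gradient f y - gradient f a) + (-(G - gradient f a) +
      ((-L) • (y - a) + (-L) • s)) := by
    rw [hw]
    have : L • (1 / L) • G = G := by rw [smul_smul, mul_one_div_cancel hL.ne', one_smul]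
    rw [show y - (a - (1 / L) • G) + s = (y - a) + s + (1 / L) • G by abel, smul_add, smul_add,
      neg_smul L ((1 / L) • G), this]
    abel
  rw [e]
  have h1 := linfNorm_add_le (gradient f y - gradient f a) (-(G - gradient f a) +
      ((-L) • (y - a) + (-L) • s))
  have h2 := linfNorm_add_le (-(G - gradient f a)) ((-L) • (y - a) + (-L) • s)
  have h3 := linfNorm_add_le ((-L) • (y - a)) ((-L) • s)
  rw [linfNorm_smul, linfNorm_smul, abs_neg, abs_of_pos hL] at h3
  rw [linfNorm_neg] at h2
  have h4 := hlip y h.1 a ha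
  have h5 := mul_le_mul_of_nonneg_left hb hL.le
  have h6 := mul_le_mul_of_nonneg_left (linfNorm_le_l1Norm (y - a)) hL.le
  nlinarith

/-- Decrease of the objective in a proximal step with an inexact gradient. -/
theorem objective_decrease {d : ℕ} {X : Set (Vec d)} (hX : Convex ℝ X)
    {f : Vec d → ℝ} (hf : Differentiable ℝ f) {L ρ : ℝ} (hL : 0 < L) (hρ : 6 ≤ ρ)
    (hlip : ∀ x ∈ X, ∀ y ∈ X, linfNorm (gradient f x - gradient f y) ≤ L * l1Norm (x - y))
    {a G y : Vec d} (ha : a ∈ X) (h : IsProxProj X (prox1 ρ) a (a - (1 / L) • G) y) :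
    f y + L * ρ / 6 * l1Norm (y - a) ^ 2 ≤
      f a + 3 / (2 * ρ * L) * linfNorm (G - gradient f a) ^ 2 := by
  have h1 := le_add_of_gradient_lipschitz hX hf hL.le hlip ha h.1
  have h2 := h.variational hX (prox1_convexOn (by linarith)) ha
  have h3 : prox1 ρ (a - a) = 0 := by simp [prox1, l1Norm_zero]
  have h4 : inner ℝ (y - (a - (1 / L) • G)) (a - y) =
      - ‖y - a‖ ^ 2 - (1 / L) * inner ℝ G (y - a) := by
    rw [show y - (a - (1 / L) • G) = (y - a) + (1 / L) • G by abel,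
      show a - y = -(y - a) by abel, inner_neg_right, inner_add_left, real_inner_smul_left,
      real_inner_self_eq_norm_sq]; ring
  have h5 := inner_le_linfNorm_mul_l1Norm (-(G - gradient f a)) (y - a)
  rw [linfNorm_neg, inner_neg_left, inner_sub_left] at h5
  rw [h3, h4, prox1] at h2
  have h6 : inner ℝ G (y - a) ≤ - (L * (ρ / 2 * l1Norm (y - a) ^ 2)) := by
    have := mul_le_mul_of_nonneg_left h2 hL.le
    have e : L * (0 + (-‖y - a‖ ^ 2 - 1 / L * inner ℝ G (y - a))) =
      -(L * ‖y - a‖ ^ 2) - inner ℝ G (y - a) := by field_simp; ring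
    rw [e] at this
    have : 0 ≤ L * ‖y - a‖ ^ 2 := by positivity
    linarith
  set D := l1Norm (y - a)
  set N := linfNorm (G - gradient f a)
  -- Of the decrease `Lρ/2`, one third pays for this Young inequality and one third for the
  -- smoothness term `L ≤ Lρ/6`; the last third is kept.
  have h7 : N * D ≤ 3 / (2 * ρ * L) * N ^ 2 + L * ρ / 6 * D ^ 2 := by
    have h : 0 ≤ 3 / (2 * ρ * L) * (N - L * ρ / 3 * D) ^ 2 := by positivity
    have e : 3 / (2 * ρ * L) * (N - L * ρ / 3 * D) ^ 2 =
        3 / (2 * ρ * L) * N ^ 2 + L * ρ / 6 * D ^ 2 - N * D := by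
      field_simp; ring
    linarith
  have h8 : 0 ≤ L * (ρ / 6 - 1) * D ^ 2 :=
    mul_nonneg (mul_nonneg hL.le (by linarith)) (sq_nonneg _)
  nlinarith

/-! ### Second moments of sums of independent noise -/

theorem two_mul_ofReal (x : ℝ) : 2 * ENNReal.ofReal x = ENNReal.ofReal (2 * x) := by
  rw [ENNReal.ofReal_mul zero_le_two, ENNReal.ofReal_ofNat]

/-- Jensen's inequality for a nonnegative continuous convex function, without an integrability
assumption on the composition. -/
theorem ofReal_map_integral_le {d : ℕ} {Ξ : Type*} [MeasurableSpace Ξ] {P : Measure Ξ}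
    [IsProbabilityMeasure P] {V : Vec d → ℝ} (hV : ConvexOn ℝ Set.univ V) (hVc : Continuous V)
    (hV0 : ∀ v, 0 ≤ V v) {H : Ξ → Vec d} (hH : Integrable H P) :
    ENNReal.ofReal (V (∫ z, H z ∂P)) ≤ ∫⁻ z, ENNReal.ofReal (V (H z)) ∂P := by
  rcases eq_or_ne (∫⁻ z, ENNReal.ofReal (V (H z)) ∂P) ⊤ with h | h
  · rw [h]; exact le_top
  · have hm : AEStronglyMeasurable (fun z => V (H z)) P :=
      hVc.comp_aestronglyMeasurable hH.aestronglyMeasurable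
    have hi : Integrable (fun z => V (H z)) P :=
      (lintegral_ofReal_ne_top_iff_integrable hm (ae_of_all _ fun z => hV0 _)).1 h
    rw [← ofReal_integral_eq_lintegral_ofReal hi (ae_of_all _ fun z => hV0 _)]
    exact ENNReal.ofReal_le_ofReal (hV.map_integral_le hVc.continuousOn isClosed_univ
      (ae_of_all _ fun _ => Set.mem_univ _) hH hi)

/-- Integrate the two-point inequality at `w ± H`. As `H` is centred, Jensen bounds the integral of
`V(w - H)` from below by `V w`, so one of the two copies of `V w` cancels. -/
theorem IsSmoothPotential.lintegral_add_le {d : ℕ} {Ξ : Type*} [MeasurableSpace Ξ]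
    {P : Measure Ξ} [IsProbabilityMeasure P] {V : Vec d → ℝ} {B : ℝ} (h : IsSmoothPotential V B)
    (hB : 0 ≤ B) {H : Ξ → Vec d} (hH : Integrable H P) (h0 : ∫ z, H z ∂P = 0) (w : Vec d) :
    ∫⁻ z, ENNReal.ofReal (V (w + H z)) ∂P ≤
      ENNReal.ofReal (V w) + ENNReal.ofReal (2 * B) *
        ∫⁻ z, ENNReal.ofReal (linfNorm (H z) ^ 2) ∂P := by
  have hm1 : AEMeasurable (fun z => ENNReal.ofReal (V (w + H z))) P :=
    (h.continuous.comp_aestronglyMeasurable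
      (hH.aestronglyMeasurable.const_add w)).aemeasurable.ennreal_ofReal
  have hj : ENNReal.ofReal (V w) ≤ ∫⁻ z, ENNReal.ofReal (V (w - H z)) ∂P := by
    have := ofReal_map_integral_le h.convexOn h.continuous h.nonneg
      ((integrable_const w).sub hH)
    simp only [Pi.sub_apply] at this
    rw [integral_sub (integrable_const w) hH, h0] at this
    simpa using this
  have hsum : ∫⁻ z, ENNReal.ofReal (V (w + H z)) ∂P + ∫⁻ z, ENNReal.ofReal (V (w - H z)) ∂P ≤
      2 * ENNReal.ofReal (V w) + ENNReal.ofReal (2 * B) *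
        ∫⁻ z, ENNReal.ofReal (linfNorm (H z) ^ 2) ∂P := by
    rw [← lintegral_add_left' hm1]
    calc ∫⁻ z, ENNReal.ofReal (V (w + H z)) + ENNReal.ofReal (V (w - H z)) ∂P
        ≤ ∫⁻ z, 2 * ENNReal.ofReal (V w) + ENNReal.ofReal (2 * B) *
            ENNReal.ofReal (linfNorm (H z) ^ 2) ∂P := by
          refine lintegral_mono fun z => ?_
          simp only
          rw [← ENNReal.ofReal_add (h.nonneg _) (h.nonneg _),
            ← ENNReal.ofReal_mul (by positivity), two_mul_ofReal,
            ← ENNReal.ofReal_add (mul_nonneg zero_le_two (h.nonneg _)) (by positivity)]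
          refine ENNReal.ofReal_le_ofReal ((h.two_point w (H z)).trans_eq (by ring))
      _ = _ := by
          rw [lintegral_add_left measurable_const, lintegral_const, measure_univ, mul_one,
            lintegral_const_mul' _ _ ENNReal.ofReal_ne_top]
  have h3 : ENNReal.ofReal (V w) + ∫⁻ z, ENNReal.ofReal (V (w + H z)) ∂P ≤
      ENNReal.ofReal (V w) + (ENNReal.ofReal (V w) + ENNReal.ofReal (2 * B) *
        ∫⁻ z, ENNReal.ofReal (linfNorm (H z) ^ 2) ∂P) := by
    calc _ ≤ ∫⁻ z, ENNReal.ofReal (V (w + H z)) ∂P + ∫⁻ z, ENNReal.ofReal (V (w - H z)) ∂P := by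
          rw [add_comm]; gcongr
      _ ≤ _ := hsum
      _ = _ := by ring
  exact (ENNReal.add_le_add_iff_left ENNReal.ofReal_ne_top).1 h3

/-- Orthogonality is not available for `‖·‖_∞`; the triangle inequality and Jensen centre at the
price of a factor 4. -/
theorem lintegral_linfNorm_sub_integral_sq_le {d : ℕ} {Ξ : Type*} [MeasurableSpace Ξ]
    {P : Measure Ξ} [IsProbabilityMeasure P] {H : Ξ → Vec d} (hH : Integrable H P) :
    ∫⁻ z, ENNReal.ofReal (linfNorm (H z - ∫ z, H z ∂P) ^ 2) ∂P ≤
      4 * ∫⁻ z, ENNReal.ofReal (linfNorm (H z) ^ 2) ∂P := by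
  have hj := ofReal_map_integral_le linfNorm_sq_convexOn (linfNorm_continuous.pow 2)
    (fun v => sq_nonneg _) hH
  calc ∫⁻ z, ENNReal.ofReal (linfNorm (H z - ∫ z, H z ∂P) ^ 2) ∂P
      ≤ ∫⁻ z, 2 * ENNReal.ofReal (linfNorm (∫ z, H z ∂P) ^ 2) +
          2 * ENNReal.ofReal (linfNorm (H z) ^ 2) ∂P := by
        refine lintegral_mono fun z => ?_
        simp only
        rw [two_mul_ofReal, two_mul_ofReal, ← ENNReal.ofReal_add (by positivity) (by positivity)]
        refine ENNReal.ofReal_le_ofReal ?_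
        have h1 := linfNorm_sub_le (H z) (∫ z, H z ∂P)
        have h2 := pow_le_pow_left₀ (linfNorm_nonneg _) h1 2
        nlinarith [sq_nonneg (linfNorm (H z) - linfNorm (∫ z, H z ∂P))]
    _ = 2 * ENNReal.ofReal (linfNorm (∫ z, H z ∂P) ^ 2) +
          2 * ∫⁻ z, ENNReal.ofReal (linfNorm (H z) ^ 2) ∂P := by
        rw [lintegral_add_left measurable_const, lintegral_const, measure_univ, mul_one,
          lintegral_const_mul' _ _ ENNReal.ofNat_ne_top]
    _ ≤ 2 * ∫⁻ z, ENNReal.ofReal (linfNorm (H z) ^ 2) ∂P +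
          2 * ∫⁻ z, ENNReal.ofReal (linfNorm (H z) ^ 2) ∂P := by gcongr
    _ = _ := by rw [← add_mul]; norm_num

/-- Integrating out an independent variable. -/
theorem lintegral_comp_of_indepFun {S U Ξ : Type*} [MeasurableSpace S] [MeasurableSpace U]
    [MeasurableSpace Ξ] {μ : Measure S} [IsProbabilityMeasure μ] {P : Measure Ξ}
    {u : S → U} {ζ : S → Ξ} (hu : Measurable u) (hζ : Measurable ζ) (hind : IndepFun u ζ μ)
    (hlaw : μ.map ζ = P) {Q : U × Ξ → ℝ≥0∞} (hQ : Measurable Q) :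
    ∫⁻ ω, Q (u ω, ζ ω) ∂μ = ∫⁻ ω, ∫⁻ z, Q (u ω, z) ∂P ∂μ := by
  subst hlaw
  have h := (indepFun_iff_map_prod_eq_prod_map_map hu.aemeasurable hζ.aemeasurable).1 hind
  have : IsProbabilityMeasure (μ.map ζ) := Measure.isProbabilityMeasure_map hζ.aemeasurable
  rw [← lintegral_map (μ := μ) hQ (hu.prodMk hζ), h, lintegral_prod _ hQ.aemeasurable,
    lintegral_map (hQ.lintegral_prod_right') hu]

/-- Growth of a smooth potential along a sum of conditionally centred terms, with fresh
independent samples. -/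
theorem IsSmoothPotential.lintegral_add_sum_le {d : ℕ} {S U Ξ : Type*} {mS : MeasurableSpace S}
    [MeasurableSpace U] [MeasurableSpace Ξ] {μ : Measure S} [IsProbabilityMeasure μ]
    {P : Measure Ξ} [IsProbabilityMeasure P] {V : Vec d → ℝ} {B : ℝ} (h : IsSmoothPotential V B)
    (hB : 0 ≤ B) {ℱ : ℕ → MeasurableSpace S} (hℱ : ∀ i, ℱ i ≤ mS) (hmono : Monotone ℱ)
    {u : S → U} {b : S → Vec d} {ζ : ℕ → S → Ξ} (hu : Measurable[ℱ 0] u)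
    (hb : Measurable[ℱ 0] b) (hζ : ∀ i, Measurable[ℱ (i + 1)] (ζ i))
    (hind : ∀ i, Indep (ℱ i) (MeasurableSpace.comap (ζ i) inferInstance) μ)
    (hlaw : ∀ i, μ.map (ζ i) = P) {H : U × Ξ → Vec d} (hH : Measurable H)
    (hint : ∀ u, Integrable (fun z => H (u, z)) P) (hcent : ∀ u, ∫ z, H (u, z) ∂P = 0)
    {τ : U → ℝ≥0∞} (hτ : ∀ u, ∫⁻ z, ENNReal.ofReal (linfNorm (H (u, z)) ^ 2) ∂P ≤ τ u)
    (c : ℝ) (n : ℕ) :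
    ∫⁻ ω, ENNReal.ofReal (V (b ω + c • ∑ i ∈ Finset.range n, H (u ω, ζ i ω))) ∂μ ≤
      ∫⁻ ω, ENNReal.ofReal (V (b ω)) ∂μ +
        n * (ENNReal.ofReal (2 * B * c ^ 2) * ∫⁻ ω, τ (u ω) ∂μ) := by
  have hW : ∀ n, Measurable[ℱ n] (fun ω => b ω + c • ∑ i ∈ Finset.range n, H (u ω, ζ i ω)) := by
    intro n
    refine Measurable.add (hb.mono (hmono (Nat.zero_le n)) le_rfl) (Measurable.const_smul ?_ c)
    refine Finset.measurable_sum _ fun i hi => hH.comp ?_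
    have hi' : i + 1 ≤ n := Finset.mem_range.1 hi
    exact (hu.mono (hmono (Nat.zero_le n)) le_rfl).prodMk ((hζ i).mono (hmono hi') le_rfl)
  induction n with
  | zero => simp
  | succ n ih =>
    set W := fun ω => b ω + c • ∑ i ∈ Finset.range n, H (u ω, ζ i ω) with hWdef
    have hun : Measurable[ℱ n] u := hu.mono (hmono (Nat.zero_le n)) le_rfl
    have hpair : Measurable[ℱ n] (fun ω => (u ω, W ω)) := hun.prodMk (hW n)
    have hindep : IndepFun (fun ω => (u ω, W ω)) (ζ n) μ :=
      indep_of_indep_of_le_left (hind n) hpair.comap_le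
    have hQ : Measurable (fun p : (U × Vec d) × Ξ =>
        ENNReal.ofReal (V (p.1.2 + c • H (p.1.1, p.2)))) := by
      refine (h.continuous.measurable.comp ?_).ennreal_ofReal
      exact (measurable_snd.comp measurable_fst).add
        ((hH.comp ((measurable_fst.comp measurable_fst).prodMk measurable_snd)).const_smul c)
    -- The `n`-th sample is integrated out with the past `(u, W)` frozen, which reduces the step to
    -- a deterministic base point.
    have e := lintegral_comp_of_indepFun (hpair.mono (hℱ n) le_rfl)
      ((hζ n).mono (hℱ _) le_rfl) hindep (hlaw n) hQ
    have hstep : ∀ ω, ∫⁻ z, ENNReal.ofReal (V (W ω + c • H (u ω, z))) ∂P ≤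
        ENNReal.ofReal (V (W ω)) + ENNReal.ofReal (2 * B * c ^ 2) * τ (u ω) := by
      intro ω
      have hi : Integrable (fun z => c • H (u ω, z)) P := (hint (u ω)).smul c
      refine (h.lintegral_add_le hB hi ?_ (W ω)).trans ?_
      · rw [integral_smul, hcent, smul_zero]
      · refine add_le_add le_rfl ?_
        have e2 : ∀ z, ENNReal.ofReal (linfNorm (c • H (u ω, z)) ^ 2) =
            ENNReal.ofReal (c ^ 2) * ENNReal.ofReal (linfNorm (H (u ω, z)) ^ 2) := fun z => by
          rw [linfNorm_smul, mul_pow, sq_abs, ENNReal.ofReal_mul (sq_nonneg _)]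
        simp only [e2]
        rw [lintegral_const_mul' _ _ ENNReal.ofReal_ne_top, ← mul_assoc,
          ← ENNReal.ofReal_mul (by positivity)]
        gcongr
        exact hτ _
    calc ∫⁻ ω, ENNReal.ofReal (V (b ω + c • ∑ i ∈ Finset.range (n + 1), H (u ω, ζ i ω))) ∂μ
        = ∫⁻ ω, ENNReal.ofReal (V (W ω + c • H (u ω, ζ n ω))) ∂μ := by
          refine lintegral_congr fun ω => ?_
          rw [Finset.sum_range_succ, smul_add, ← add_assoc]
      _ = ∫⁻ ω, ∫⁻ z, ENNReal.ofReal (V (W ω + c • H (u ω, z))) ∂P ∂μ := e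
      _ ≤ ∫⁻ ω, ENNReal.ofReal (V (W ω)) + ENNReal.ofReal (2 * B * c ^ 2) * τ (u ω) ∂μ :=
          lintegral_mono hstep
      _ = ∫⁻ ω, ENNReal.ofReal (V (W ω)) ∂μ +
            ENNReal.ofReal (2 * B * c ^ 2) * ∫⁻ ω, τ (u ω) ∂μ := by
          have hm : Measurable (fun ω => ENNReal.ofReal (V (W ω))) :=
            (h.continuous.measurable.comp ((hW n).mono (hℱ n) le_rfl)).ennreal_ofReal
          rw [lintegral_add_left hm, lintegral_const_mul' _ _ ENNReal.ofReal_ne_top]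
      _ ≤ _ := by
          rw [Nat.cast_succ, add_mul, one_mul, ← add_assoc]
          gcongr

/-! ### The history of the sampling -/

section Past

variable {d : ℕ} {Ξ S : Type*} [MeasurableSpace Ξ]

/-- The `σ`-algebra generated by the initial point and the samples with index in `T`. -/
@[reducible] def past (x₁ : S → Vec d) (ζ : ℕ → ℕ → S → Ξ) (T : Set (ℕ × ℕ)) : MeasurableSpace S :=
  MeasurableSpace.comap (fun ω => (x₁ ω, fun p : T => ζ p.1.1 p.1.2 ω)) inferInstance

theorem past_mono {x₁ : S → Vec d} {ζ : ℕ → ℕ → S → Ξ} {T T' : Set (ℕ × ℕ)} (h : T ⊆ T') :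
    past x₁ ζ T ≤ past x₁ ζ T' := by
  have hm : Measurable (fun q : Vec d × (T' → Ξ) => (q.1, fun p : T => q.2 ⟨p.1, h p.2⟩)) :=
    measurable_fst.prodMk (measurable_pi_lambda _ fun p =>
      (measurable_pi_apply _).comp measurable_snd)
  refine Measurable.comap_le ?_
  exact hm.comp (comap_measurable (fun ω => (x₁ ω, fun p : T' => ζ p.1.1 p.1.2 ω)))

theorem measurable_init_past (x₁ : S → Vec d) (ζ : ℕ → ℕ → S → Ξ) (T : Set (ℕ × ℕ)) :
    Measurable[past x₁ ζ T] x₁ :=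
  measurable_fst.comp (comap_measurable (fun ω => (x₁ ω, fun p : T => ζ p.1.1 p.1.2 ω)))

theorem measurable_sample_past (x₁ : S → Vec d) (ζ : ℕ → ℕ → S → Ξ) {T : Set (ℕ × ℕ)} {k i : ℕ}
    (h : (k, i) ∈ T) : Measurable[past x₁ ζ T] (ζ k i) :=
  ((measurable_pi_apply (⟨(k, i), h⟩ : T)).comp measurable_snd).comp
    (comap_measurable (fun ω => (x₁ ω, fun p : T => ζ p.1.1 p.1.2 ω)))

theorem past_le_comap (x₁ : S → Vec d) (ζ : ℕ → ℕ → S → Ξ) (T : Set (ℕ × ℕ)) :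
    past x₁ ζ T ≤
      MeasurableSpace.comap (fun ω => (x₁ ω, fun p : ℕ × ℕ => ζ p.1 p.2 ω)) inferInstance := by
  have hm : Measurable (fun q : Vec d × (ℕ × ℕ → Ξ) => (q.1, fun p : T => q.2 p.1)) :=
    measurable_fst.prodMk (measurable_pi_lambda _ fun p =>
      (measurable_pi_apply _).comp measurable_snd)
  refine Measurable.comap_le ?_
  exact hm.comp (comap_measurable (fun ω => (x₁ ω, fun p : ℕ × ℕ => ζ p.1 p.2 ω)))

variable [mS : MeasurableSpace S] {P : Measure Ξ} {μ : Measure S}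
  {K : ℕ} {ζ : ℕ → ℕ → S → Ξ} {x₁ : S → Vec d} {Y : S → ℕ}

theorem IsSampling.past_le (h : IsSampling P μ K ζ x₁ Y) (T : Set (ℕ × ℕ)) :
    past x₁ ζ T ≤ mS :=
  (h.measurable_init.prodMk (measurable_pi_lambda _ fun _ => h.measurable_sample _ _)).comap_le

variable [IsProbabilityMeasure μ]

/-- Both hypotheses together factor the joint law of the triple; only the bracketing of the product
changes. -/
theorem indepFun_prodMk_of_indepFun {α β γ : Type*} [MeasurableSpace α] [MeasurableSpace β]
    [MeasurableSpace γ] {f : S → α} {g : S → β} {k : S → γ} (hf : Measurable f)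
    (hg : Measurable g) (hk : Measurable k) (h1 : IndepFun f (fun ω => (g ω, k ω)) μ)
    (h2 : IndepFun g k μ) : IndepFun (fun ω => (f ω, g ω)) k μ := by
  have hfg : IndepFun f g μ := h1.comp measurable_id measurable_fst
  rw [indepFun_iff_map_prod_eq_prod_map_map (hf.prodMk hg).aemeasurable hk.aemeasurable,
    (indepFun_iff_map_prod_eq_prod_map_map hf.aemeasurable hg.aemeasurable).1 hfg]
  rw [indepFun_iff_map_prod_eq_prod_map_map hf.aemeasurable (hg.prodMk hk).aemeasurable,
    (indepFun_iff_map_prod_eq_prod_map_map hg.aemeasurable hk.aemeasurable).1 h2] at h1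
  have := Measure.isProbabilityMeasure_map (μ := μ) hf.aemeasurable
  have := Measure.isProbabilityMeasure_map (μ := μ) hg.aemeasurable
  have := Measure.isProbabilityMeasure_map (μ := μ) hk.aemeasurable
  apply MeasurableEquiv.prodAssoc.map_measurableEquiv_injective
  rw [(measurePreserving_prodAssoc _ _ _).map_eq, ← h1,
    Measure.map_map MeasurableEquiv.prodAssoc.measurable ((hf.prodMk hg).prodMk hk)]
  rfl

/-- Disjoint families of samples are independent, and the initial point is independent of all
samples jointly; the two facts are combined through the triple product law. -/
theorem IsSampling.indep_past (h : IsSampling P μ K ζ x₁ Y) {T : Set (ℕ × ℕ)} {k i : ℕ}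
    (hki : (k, i) ∉ T) :
    Indep (past x₁ ζ T) (MeasurableSpace.comap (ζ k i) inferInstance) μ := by
  have hT : Measurable (fun ω (p : T) => ζ p.1.1 p.1.2 ω) :=
    measurable_pi_lambda _ fun _ => h.measurable_sample _ _
  refine indepFun_prodMk_of_indepFun h.measurable_init hT (h.measurable_sample k i) ?_ ?_
  · have hm : Measurable (fun q : ℕ × ℕ → Ξ => (fun p : T => q p.1, q (k, i))) :=
      (measurable_pi_lambda _ fun p => measurable_pi_apply _).prodMk (measurable_pi_apply _)
    exact h.indep_init.comp measurable_id hm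
  · have h1 := indep_iSup_of_disjoint
      (fun p : ℕ × ℕ => (h.measurable_sample p.1 p.2).comap_le) h.indep_samples.iIndep
      (Set.disjoint_singleton_right.2 hki)
    rw [iSup_singleton] at h1
    refine indep_of_indep_of_le_left h1 ?_
    rw [MeasurableSpace.pi, MeasurableSpace.comap_iSup]
    refine iSup_le fun p => ?_
    rw [MeasurableSpace.comap_comp]
    exact le_iSup₂_of_le p.1 p.2 le_rfl

end Past

/-! ### Consequences of the assumptions on the problem -/

section Problem

variable {d : ℕ} {Ξ : Type*} [MeasurableSpace Ξ] {P : Measure Ξ} {X : Set (Vec d)}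
  {F : Vec d → Ξ → ℝ} {σ L flow : ℝ}

theorem IsProblem.integral_stochGrad_sub (h : IsProblem P X F σ L flow) {x y : Vec d}
    (hx : x ∈ X) (hy : y ∈ X) :
    ∫ z, (stochGrad F x z - stochGrad F y z) ∂P =
      gradient (objective P F) x - gradient (objective P F) y := by
  rw [integral_sub (h.unbiased x hx).1 (h.unbiased y hy).1, (h.unbiased x hx).2,
    (h.unbiased y hy).2]

/-- Jensen's inequality turns mean-square smoothness of the stochastic gradients into Lipschitz
continuity of their mean `∇f`, with the same constant. -/
theorem IsProblem.gradient_lipschitz [IsProbabilityMeasure P] (h : IsProblem P X F σ L flow)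
    (hL : 0 ≤ L) : ∀ x ∈ X, ∀ y ∈ X,
      linfNorm (gradient (objective P F) x - gradient (objective P F) y) ≤ L * l1Norm (x - y) := by
  intro x hx y hy
  have h1 := ofReal_map_integral_le linfNorm_sq_convexOn (linfNorm_continuous.pow 2)
    (fun v => sq_nonneg _) ((h.unbiased x hx).1.sub (h.unbiased y hy).1)
  simp only [Pi.sub_apply] at h1
  rw [h.integral_stochGrad_sub hx hy] at h1
  have h2 := h1.trans (h.meanSquare_lipschitz x hx y hy)
  rw [ENNReal.ofReal_le_ofReal_iff (by positivity), ← mul_pow] at h2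
  exact le_of_sq_le_sq h2 (mul_nonneg hL (l1Norm_nonneg _))

theorem IsProblem.lintegral_noise_sub_le [IsProbabilityMeasure P]
    (h : IsProblem P X F σ L flow) {x y : Vec d} (hx : x ∈ X) (hy : y ∈ X) :
    ∫⁻ z, ENNReal.ofReal (linfNorm ((stochGrad F x z - stochGrad F y z) -
        (gradient (objective P F) x - gradient (objective P F) y)) ^ 2) ∂P
      ≤ ENNReal.ofReal (4 * L ^ 2) * ENNReal.ofReal (l1Norm (x - y) ^ 2) := by
  have h1 := lintegral_linfNorm_sub_integral_sq_le
    ((h.unbiased x hx).1.sub (h.unbiased y hy).1)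
  simp only [Pi.sub_apply] at h1
  rw [h.integral_stochGrad_sub hx hy] at h1
  refine h1.trans ((mul_le_mul_right (h.meanSquare_lipschitz x hx y hy) _).trans_eq ?_)
  rw [← ENNReal.ofReal_mul (by positivity), ← ENNReal.ofReal_ofNat 4,
    ← ENNReal.ofReal_mul (by norm_num), mul_assoc]

/-- By unbiasedness `∇f` is, on `X`, a parametric integral of a jointly measurable function. -/
theorem IsProblem.measurable_gradient [SFinite P] (h : IsProblem P X F σ L flow) :
    Measurable (fun x : X => gradient (objective P F) (x : Vec d)) := by
  have h1 : (fun x : X => gradient (objective P F) (x : Vec d)) =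
      fun x : X => ∫ z, stochGrad F (x : Vec d) z ∂P := by
    funext x; exact ((h.unbiased x x.2).2).symm
  rw [h1]
  exact (h.measurable_grad.stronglyMeasurable.integral_prod_right').measurable

end Problem

/-! ### Feasibility and adaptedness of the iterates -/

theorem IsRun.mem {d : ℕ} {Ξ S : Type*} {X : Set (Vec d)} {F : Vec d → Ξ → ℝ} {η ρ : ℝ}
    {K q m m₁ : ℕ} {ζ : ℕ → ℕ → S → Ξ} {x G : ℕ → S → Vec d}
    (hR : IsRun X F η ρ K q m m₁ ζ x G) {k : ℕ} (h1 : 1 ≤ k) (hK : k ≤ K + 1)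
    (ω : S) : x k ω ∈ X := by
  rcases eq_or_lt_of_le h1 with rfl | hk
  · exact hR.init_mem ω
  · obtain ⟨j, rfl⟩ : ∃ j, k = j + 1 := ⟨k - 1, by omega⟩
    exact (hR.step j (Finset.mem_Icc.2 ⟨by omega, by omega⟩) ω).1

section Run

variable {d : ℕ} {Ξ S : Type*} [MeasurableSpace Ξ] {P : Measure Ξ}
  {X : Set (Vec d)} {F : Vec d → Ξ → ℝ} {σ L flow η ρ : ℝ} {K q m m₁ : ℕ}
  {ζ : ℕ → ℕ → S → Ξ} {x G : ℕ → S → Vec d}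

/-- The iterates are adapted to the history of the sampling. -/
theorem IsRun.measurable_past (hP : IsProblem P X F σ L flow) (hρ : 0 ≤ ρ)
    (hR : IsRun X F η ρ K q m m₁ ζ x G) (k : ℕ) (hk : k ≤ K) :
    Measurable[past (x 1) ζ {p | p.1 < k + 1}] (x (k + 1)) ∧
      (1 ≤ k → Measurable[past (x 1) ζ {p | p.1 < k + 1}] (x k) ∧
        Measurable[past (x 1) ζ {p | p.1 < k + 1}] (G k)) := by
  induction k with
  | zero => exact ⟨measurable_init_past _ _ _, fun h => absurd h (by omega)⟩
  | succ k ih =>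
    have hmono : past (x 1) ζ {p | p.1 < k + 1} ≤ past (x 1) ζ {p | p.1 < k + 1 + 1} :=
      past_mono fun p hp => Nat.lt_succ_of_lt hp
    obtain ⟨ihx, ihG⟩ := ih (by omega)
    have hx : Measurable[past (x 1) ζ {p | p.1 < k + 1 + 1}] (x (k + 1)) :=
      ihx.mono hmono le_rfl
    have hζ : ∀ i, Measurable[past (x 1) ζ {p | p.1 < k + 1 + 1}] (ζ (k + 1) i) := fun i =>
      measurable_sample_past _ _ (Nat.lt_succ_self _)
    have hgrad : ∀ j, ∀ _ : 1 ≤ j ∧ j ≤ K + 1,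
        Measurable[past (x 1) ζ {p | p.1 < k + 1 + 1}] (x j) → ∀ i,
        Measurable[past (x 1) ζ {p | p.1 < k + 1 + 1}]
          (fun ω => stochGrad F (x j ω) (ζ (k + 1) i ω)) := fun j hj hxj i =>
      hP.measurable_grad.comp ((hxj.subtype_mk (h := fun ω => hR.mem hj.1 hj.2 ω)).prodMk (hζ i))
    have hsum : ∀ j, ∀ _ : 1 ≤ j ∧ j ≤ K + 1,
        Measurable[past (x 1) ζ {p | p.1 < k + 1 + 1}] (x j) →
        Measurable[past (x 1) ζ {p | p.1 < k + 1 + 1}]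
          (fun ω => ∑ i ∈ Finset.range (batchSize q m m₁ (k + 1)),
            stochGrad F (x j ω) (ζ (k + 1) i ω)) := fun j hj hxj =>
      Finset.measurable_sum _ fun i _ => hgrad j hj hxj i
    have hmem : k + 1 ∈ Finset.Icc 1 K := Finset.mem_Icc.2 ⟨by omega, hk⟩
    have hG : Measurable[past (x 1) ζ {p | p.1 < k + 1 + 1}] (G (k + 1)) := by
      by_cases hq : k + 1 ≡ 1 [MOD q]
      · rw [funext (hR.refresh _ hmem hq)]
        exact (hsum (k + 1) (by omega) hx).const_smul (batchSize q m m₁ (k + 1) : ℝ)⁻¹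
      -- Iteration 1 is a refresh for every `q`, so a correction always has a predecessor.
      · have hk0 : 1 ≤ k := by
          rcases Nat.eq_zero_or_pos k with rfl | h
          · exact absurd rfl hq
          · exact h
        obtain ⟨hxk, hGk⟩ := ihG hk0
        rw [funext (hR.recursion _ hmem hq), Nat.add_sub_cancel]
        exact (((hsum (k + 1) (by omega) hx).sub
          (hsum k (by omega) (hxk.mono hmono le_rfl))).const_smul
            (batchSize q m m₁ (k + 1) : ℝ)⁻¹).add (hGk.mono hmono le_rfl)
    refine ⟨?_, fun _ => ⟨hx, hG⟩⟩
    exact measurable_of_isProxProj hP.convex hρ hx (hx.sub (hG.const_smul η))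
      (fun ω => hR.mem (by omega) (by omega) ω) (hR.step _ hmem)

end Run

/-! ### Expected decrease, random output index, and error recursion -/

section Estimates

variable {d : ℕ} {Ξ S : Type*} [MeasurableSpace Ξ] {P : Measure Ξ}
  {X : Set (Vec d)} {F : Vec d → Ξ → ℝ} {σ L flow η ρ : ℝ} {K q m m₁ : ℕ}
  {ζ : ℕ → ℕ → S → Ξ} {x G : ℕ → S → Vec d}

/-- The error of the gradient estimate. -/
noncomputable def gradError (P : Measure Ξ) (F : Vec d → Ξ → ℝ)
    (x G : ℕ → S → Vec d) (k : ℕ) (ω : S) : Vec d :=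
  G k ω - gradient (objective P F) (x k ω)

theorem IsRun.measurable_gradError_past [SFinite P] (hP : IsProblem P X F σ L flow) (hρ : 0 ≤ ρ)
    (hR : IsRun X F η ρ K q m m₁ ζ x G) {k : ℕ} (h1 : 1 ≤ k) (hk : k ≤ K) :
    Measurable[past (x 1) ζ {p | p.1 < k + 1}] (gradError P F x G k) := by
  obtain ⟨hx, hG⟩ := (hR.measurable_past hP hρ k hk).2 h1
  exact hG.sub (hP.measurable_gradient.comp
    (hx.subtype_mk (h := fun ω => hR.mem h1 (by omega) ω)))

variable [MeasurableSpace S] {μ : Measure S} {Y : S → ℕ}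

theorem IsRun.measurable_iterate (hP : IsProblem P X F σ L flow)
    (hS : IsSampling P μ K ζ (x 1) Y) (hρ : 0 ≤ ρ) (hR : IsRun X F η ρ K q m m₁ ζ x G) {k : ℕ}
    (h1 : 1 ≤ k) (hk : k ≤ K + 1) : Measurable (x k) := by
  obtain ⟨j, rfl⟩ : ∃ j, k = j + 1 := ⟨k - 1, by omega⟩
  exact (hR.measurable_past hP hρ j (by omega)).1.mono (hS.past_le _) le_rfl

/-- Expected decrease of the objective gap. -/
theorem IsRun.lintegral_decrease [IsProbabilityMeasure P] {V : Vec d → ℝ} {B : ℝ}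
    (hP : IsProblem P X F σ L flow)
    (hS : IsSampling P μ K ζ (x 1) Y) (hL : 0 < L) (hρ : 6 ≤ ρ)
    (hR : IsRun X F (1 / L) ρ K q m m₁ ζ x G) (hV : IsSmoothPotential V B) {k : ℕ} (h1 : 1 ≤ k)
    (hk : k ≤ K) :
    ∫⁻ ω, ENNReal.ofReal (objective P F (x (k + 1) ω) - flow) ∂μ +
        ENNReal.ofReal (L * ρ / 6) * ∫⁻ ω, ENNReal.ofReal (l1Norm (x (k + 1) ω - x k ω) ^ 2) ∂μ ≤
      ∫⁻ ω, ENNReal.ofReal (objective P F (x k ω) - flow) ∂μ +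
        ENNReal.ofReal (3 / (2 * ρ * L)) *
          ∫⁻ ω, ENNReal.ofReal (V (gradError P F x G k ω)) ∂μ := by
  have hf : Measurable (objective P F) := hP.differentiable_objective.continuous.measurable
  have hm : ∀ j, 1 ≤ j → j ≤ K + 1 →
      Measurable (fun ω => ENNReal.ofReal (objective P F (x j ω) - flow)) := fun j h h' =>
    ((hf.comp (hR.measurable_iterate hP hS (by linarith) h h')).sub_const _).ennreal_ofReal
  rw [← lintegral_const_mul' _ _ ENNReal.ofReal_ne_top,
    ← lintegral_const_mul' _ _ ENNReal.ofReal_ne_top,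
    ← lintegral_add_left (hm _ (by omega) (by omega)), ← lintegral_add_left (hm _ h1 (by omega))]
  refine lintegral_mono fun ω => ?_
  have hk1 := hR.mem (k := k + 1) (by omega) (by omega) ω
  have hk0 := hR.mem (k := k) h1 (by omega) ω
  have hdec := objective_decrease hP.convex hP.differentiable_objective hL hρ
    (hP.gradient_lipschitz hL.le) hk0 (hR.step k (Finset.mem_Icc.2 ⟨h1, hk⟩) ω)
  -- The gaps to `flow` are nonnegative on `X`, so `ENNReal.ofReal` is additive on both sides.
  have hl1 := hP.lower_bound _ hk1
  have hl0 := hP.lower_bound _ hk0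
  have hb0 : 0 ≤ 3 / (2 * ρ * L) := by positivity
  simp only
  rw [← ENNReal.ofReal_mul (by positivity), ← ENNReal.ofReal_mul hb0,
    ← ENNReal.ofReal_add (by linarith) (by positivity),
    ← ENNReal.ofReal_add (by linarith) (mul_nonneg hb0 (hV.nonneg _))]
  refine ENNReal.ofReal_le_ofReal ?_
  have := mul_le_mul_of_nonneg_left (hV.linf_le (gradError P F x G k ω)) hb0
  rw [gradError] at this ⊢
  linarith

variable [IsProbabilityMeasure μ]

/-- The expected residual at a uniformly chosen index is at most the average of the bounds. -/
theorem IsSampling.lintegral_index_le (hS : IsSampling P μ K ζ (x 1) Y) (hK : 0 < K)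
    {Q : ℕ → S → ℝ≥0∞} {R : ℕ → S → ℝ≥0∞}
    (hR : ∀ k ∈ Finset.Icc 1 K, Measurable[past (x 1) ζ Set.univ] (R k))
    (hQ : ∀ k ∈ Finset.Icc 1 K, ∀ ω, Q k ω ≤ R k ω) :
    ∫⁻ ω, Q (Y ω) ω ∂μ ≤ ∑ k ∈ Finset.Icc 1 K, (K : ℝ≥0∞)⁻¹ * ∫⁻ ω, R k ω ∂μ := by
  have hKne : (K : ℝ≥0∞) ≠ 0 := by exact_mod_cast hK.ne'
  have hset : ∀ k, MeasurableSet {ω | Y ω = k} := fun k =>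
    hS.measurable_index (measurableSet_singleton k)
  -- The `K` masses `1/K` sum to one, so almost surely no other index occurs.
  have hmem : ∀ᵐ ω ∂μ, Y ω ∈ Finset.Icc 1 K := by
    have h1 : μ {ω | Y ω ∈ Finset.Icc 1 K} = 1 := by
      have e : {ω | Y ω ∈ Finset.Icc 1 K} = ⋃ k ∈ Finset.Icc 1 K, {ω | Y ω = k} := by
        ext ω; simp
      rw [e, measure_biUnion_finset _ fun k _ => hset k, Finset.sum_congr rfl hS.law_index]
      · simp [ENNReal.mul_inv_cancel hKne]
      · intro i _ j _ hij
        exact Set.disjoint_left.2 fun ω h1 h2 => hij (h1.symm.trans h2)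
    have hms : MeasurableSet {ω | Y ω ∈ Finset.Icc 1 K} :=
      hS.measurable_index (Finset.measurableSet _)
    exact (prob_compl_eq_zero_iff hms).2 h1
  have hmul : ∀ k ∈ Finset.Icc 1 K,
      ∫⁻ ω, {ω | Y ω = k}.indicator 1 ω * R k ω ∂μ = (K : ℝ≥0∞)⁻¹ * ∫⁻ ω, R k ω ∂μ := by
    intro k hk
    have hind : IndepFun ({ω | Y ω = k}.indicator (1 : S → ℝ≥0∞)) (R k) μ := by
      have h1 : {ω | Y ω = k}.indicator (1 : S → ℝ≥0∞) =
          (({k} : Set ℕ).indicator 1) ∘ Y := by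
        rfl
      rw [h1]
      refine indep_of_indep_of_le_left (indep_of_indep_of_le_right hS.indep_index
        ((hR k hk).comap_le.trans (past_le_comap _ _ _))) ?_
      rw [← MeasurableSpace.comap_comp]
      exact MeasurableSpace.comap_mono (measurable_from_nat).comap_le
    have := lintegral_mul_eq_lintegral_mul_lintegral_of_indepFun
      (measurable_one.indicator (hset k)) ((hR k hk).mono (hS.past_le _) le_rfl) hind
    simp only [Pi.mul_apply] at this
    rw [this, lintegral_indicator_one (hset k), hS.law_index k hk]
  -- `Q` is replaced by its measurable majorant before anything is split, so the residual itself
  -- need not be measurable.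
  calc ∫⁻ ω, Q (Y ω) ω ∂μ
      ≤ ∫⁻ ω, ∑ k ∈ Finset.Icc 1 K, {ω | Y ω = k}.indicator 1 ω * R k ω ∂μ := by
        refine lintegral_mono_ae ?_
        filter_upwards [hmem] with ω hω
        rw [Finset.sum_eq_single_of_mem (Y ω) hω]
        · simpa using hQ _ hω ω
        · intro k _ hk
          rw [Set.indicator_of_notMem (show ω ∉ {ω | Y ω = k} from fun h => hk (Eq.symm h)),
            zero_mul]
    _ = ∑ k ∈ Finset.Icc 1 K, ∫⁻ ω, {ω | Y ω = k}.indicator 1 ω * R k ω ∂μ :=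
        lintegral_finsetSum _ fun k hk =>
          (measurable_one.indicator (hset k)).mul ((hR k hk).mono (hS.past_le _) le_rfl)
    _ = _ := Finset.sum_congr rfl hmul

variable [IsProbabilityMeasure P] {V : Vec d → ℝ} {B : ℝ}

/-- One batch of fresh samples added to a base that depends on the past only. -/
theorem IsSampling.lintegral_add_batch_le (hS : IsSampling P μ K ζ (x 1) Y)
    (hV : IsSmoothPotential V B) (hB : 0 ≤ B) (k : ℕ) {U : Type*} [MeasurableSpace U]
    {u : S → U} {b : S → Vec d} (hu : Measurable[past (x 1) ζ {p | p.1 < k}] u)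
    (hb : Measurable[past (x 1) ζ {p | p.1 < k}] b) {H : U × Ξ → Vec d} (hH : Measurable H)
    (hint : ∀ u, Integrable (fun z => H (u, z)) P) (hcent : ∀ u, ∫ z, H (u, z) ∂P = 0)
    {τ : U → ℝ≥0∞} (hτ : ∀ u, ∫⁻ z, ENNReal.ofReal (linfNorm (H (u, z)) ^ 2) ∂P ≤ τ u)
    {n : ℕ} (hn : 0 < n) :
    ∫⁻ ω, ENNReal.ofReal (V (b ω + (n : ℝ)⁻¹ •
        ∑ i ∈ Finset.range n, H (u ω, ζ k i ω))) ∂μ ≤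
      ∫⁻ ω, ENNReal.ofReal (V (b ω)) ∂μ + ENNReal.ofReal (2 * B / n) * ∫⁻ ω, τ (u ω) ∂μ := by
  -- Within iteration `k` the history grows sample by sample; at `i = 0` the second clause is empty
  -- and only earlier iterations remain.
  have hsub : {p : ℕ × ℕ | p.1 < k} ⊆ {p | p.1 < k ∨ p.1 = k ∧ p.2 < 0} := fun p hp => Or.inl hp
  have h := hV.lintegral_add_sum_le (μ := μ) (P := P) hB
    (ℱ := fun i => past (x 1) ζ {p | p.1 < k ∨ p.1 = k ∧ p.2 < i})
    (fun i => hS.past_le _)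
    (fun i j hij => past_mono fun p hp => hp.imp_right fun h => ⟨h.1, h.2.trans_le hij⟩)
    (hu.mono (past_mono hsub) le_rfl) (hb.mono (past_mono hsub) le_rfl) (ζ := ζ k)
    (fun i => measurable_sample_past _ _ (Or.inr ⟨rfl, Nat.lt_succ_self i⟩))
    (fun i => hS.indep_past (by simp)) (fun i => hS.law_sample k i) hH hint hcent hτ
    (n : ℝ)⁻¹ n
  refine h.trans_eq ?_
  congr 1
  have hn' : (0 : ℝ) < n := by exact_mod_cast hn
  rw [← mul_assoc, ← ENNReal.ofReal_natCast, ← ENNReal.ofReal_mul hn'.le]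
  congr 2
  field_simp

/-- The error is an average of `m₁` centred terms started from `V 0 = 0`; `m₁` increments with
weight `1/m₁²` give `2B/m₁`. -/
theorem IsRun.lintegral_gradError_refresh (hP : IsProblem P X F σ L flow)
    (hS : IsSampling P μ K ζ (x 1) Y) (hρ : 0 ≤ ρ) (hR : IsRun X F η ρ K q m m₁ ζ x G)
    (hV : IsSmoothPotential V B) (hB : 0 ≤ B) (hm₁ : 0 < m₁) {k : ℕ} (h1 : 1 ≤ k) (hk : k ≤ K)
    (hq : k ≡ 1 [MOD q]) :
    ∫⁻ ω, ENNReal.ofReal (V (gradError P F x G k ω)) ∂μ ≤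
      ENNReal.ofReal (2 * B / m₁ * σ ^ 2) := by
  have hx : Measurable[past (x 1) ζ {p | p.1 < k}] (x k) := by
    obtain ⟨j, rfl⟩ : ∃ j, k = j + 1 := ⟨k - 1, by omega⟩
    exact (hR.measurable_past hP hρ j (by omega)).1
  have h := hS.lintegral_add_batch_le hV hB k (b := fun _ => 0)
    (hx.subtype_mk (h := fun ω => hR.mem h1 (by omega) ω)) measurable_const
    (H := fun p : X × Ξ => stochGrad F (p.1 : Vec d) p.2 - gradient (objective P F) p.1)
    (hP.measurable_grad.sub (hP.measurable_gradient.comp measurable_fst))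
    (fun u => (hP.unbiased u u.2).1.sub
      (integrable_const (gradient (objective P F) (u : Vec d))))
    (fun u => by
      simp only
      rw [integral_sub (hP.unbiased u u.2).1 (integrable_const _), (hP.unbiased u u.2).2]
      simp)
    (τ := fun _ => ENNReal.ofReal (σ ^ 2)) (fun u => hP.variance_le u u.2) hm₁
  have hm' : (m₁ : ℝ) ≠ 0 := by exact_mod_cast hm₁.ne'
  calc _ = ∫⁻ ω, ENNReal.ofReal (V (0 + (m₁ : ℝ)⁻¹ • ∑ i ∈ Finset.range m₁,
          (stochGrad F (x k ω) (ζ k i ω) - gradient (objective P F) (x k ω)))) ∂μ := by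
        refine lintegral_congr fun ω => ?_
        rw [gradError, hR.refresh k (Finset.mem_Icc.2 ⟨h1, hk⟩) hq, batchSize, if_pos hq,
          Finset.sum_sub_distrib, Finset.sum_const, Finset.card_range, zero_add, smul_sub,
          ← Nat.cast_smul_eq_nsmul ℝ, smul_smul, inv_mul_cancel₀ hm', one_smul]
    _ ≤ _ := h
    _ = _ := by
        simp only [lintegral_const, measure_univ, mul_one, hV.map_zero, ENNReal.ofReal_zero,
          zero_add]
        rw [← ENNReal.ofReal_mul (by positivity)]

/-- The new error is the old one plus a batch average of gradient differences that are centred given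
the past. Their second moment is at most `4L²‖x^{k+1} - x^k‖₁²`, whence `2B · 4L²/m`. -/
theorem IsRun.lintegral_gradError_recursion (hP : IsProblem P X F σ L flow)
    (hS : IsSampling P μ K ζ (x 1) Y) (hρ : 0 ≤ ρ) (hR : IsRun X F η ρ K q m m₁ ζ x G)
    (hV : IsSmoothPotential V B) (hB : 0 ≤ B) (hm : 0 < m) {k : ℕ} (h1 : 1 ≤ k)
    (hk : k + 1 ≤ K) (hq : ¬ k + 1 ≡ 1 [MOD q]) :
    ∫⁻ ω, ENNReal.ofReal (V (gradError P F x G (k + 1) ω)) ∂μ ≤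
      ∫⁻ ω, ENNReal.ofReal (V (gradError P F x G k ω)) ∂μ + ENNReal.ofReal (8 * B * L ^ 2 / m) *
        ∫⁻ ω, ENNReal.ofReal (l1Norm (x (k + 1) ω - x k ω) ^ 2) ∂μ := by
  have hx1 : Measurable[past (x 1) ζ {p | p.1 < k + 1}] (x (k + 1)) :=
    (hR.measurable_past hP hρ k (by omega)).1
  have hx : Measurable[past (x 1) ζ {p | p.1 < k + 1}] (x k) :=
    ((hR.measurable_past hP hρ k (by omega)).2 h1).1
  have hg : Measurable (fun p : (X × X) × Ξ =>
      gradient (objective P F) (p.1.1 : Vec d) - gradient (objective P F) (p.1.2 : Vec d)) :=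
    (hP.measurable_gradient.comp (measurable_fst.comp measurable_fst)).sub
      (hP.measurable_gradient.comp (measurable_snd.comp measurable_fst))
  have hs : Measurable (fun p : (X × X) × Ξ =>
      stochGrad F (p.1.1 : Vec d) p.2 - stochGrad F (p.1.2 : Vec d) p.2) :=
    (hP.measurable_grad.comp ((measurable_fst.comp measurable_fst).prodMk measurable_snd)).sub
      (hP.measurable_grad.comp ((measurable_snd.comp measurable_fst).prodMk measurable_snd))
  have hi : ∀ u : X × X, Integrable (fun z => stochGrad F (u.1 : Vec d) z -
      stochGrad F (u.2 : Vec d) z) P := fun u =>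
    (hP.unbiased _ u.1.2).1.sub (hP.unbiased _ u.2.2).1
  have hpair : Measurable[past (x 1) ζ {p | p.1 < k + 1}] (fun ω =>
      ((⟨x (k + 1) ω, hR.mem (by omega) (by omega) ω⟩, ⟨x k ω, hR.mem h1 (by omega) ω⟩) :
        X × X)) :=
    hx1.subtype_mk.prodMk hx.subtype_mk
  set H : (X × X) × Ξ → Vec d := fun p =>
    (stochGrad F (p.1.1 : Vec d) p.2 - stochGrad F (p.1.2 : Vec d) p.2) -
      (gradient (objective P F) (p.1.1 : Vec d) - gradient (objective P F) (p.1.2 : Vec d))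
    with hH
  have hHi : ∀ u, Integrable (fun z => H (u, z)) P := fun u => (hi u).sub (integrable_const
    (gradient (objective P F) (u.1 : Vec d) - gradient (objective P F) (u.2 : Vec d)))
  have hHc : ∀ u, ∫ z, H (u, z) ∂P = 0 := by
    intro u
    rw [hH]
    simp only
    rw [integral_sub (hi u) (integrable_const _), hP.integral_stochGrad_sub u.1.2 u.2.2]
    simp
  have hHτ : ∀ u : X × X, ∫⁻ z, ENNReal.ofReal (linfNorm (H (u, z)) ^ 2) ∂P ≤
      ENNReal.ofReal (4 * L ^ 2) * ENNReal.ofReal (l1Norm ((u.1 : Vec d) - (u.2 : Vec d)) ^ 2) := by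
    intro u
    have h := hP.lintegral_noise_sub_le (x := (u.1 : Vec d)) (y := (u.2 : Vec d)) u.1.2 u.2.2
    simpa only [hH] using h
  have hHm : Measurable H := hs.sub hg
  have hb : Measurable[past (x 1) ζ {p | p.1 < k + 1}] (gradError P F x G k) :=
    hR.measurable_gradError_past hP hρ h1 (by omega)
  have h := hS.lintegral_add_batch_le hV hB (k + 1) hpair hb hHm hHi hHc hHτ hm
  have hm' : (m : ℝ) ≠ 0 := by exact_mod_cast hm.ne'
  have e : ∀ ω, gradError P F x G (k + 1) ω = gradError P F x G k ω + (m : ℝ)⁻¹ •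
      ∑ i ∈ Finset.range m,
        ((stochGrad F (x (k + 1) ω) (ζ (k + 1) i ω) - stochGrad F (x k ω) (ζ (k + 1) i ω)) -
          (gradient (objective P F) (x (k + 1) ω) - gradient (objective P F) (x k ω))) := by
    intro ω
    rw [gradError, hR.recursion (k + 1) (Finset.mem_Icc.2 ⟨by omega, hk⟩) hq, batchSize,
      if_neg hq, Nat.add_sub_cancel, Finset.sum_sub_distrib, Finset.sum_sub_distrib,
      Finset.sum_const, Finset.card_range, smul_sub _ _ (m • _), ← Nat.cast_smul_eq_nsmul ℝ,
      smul_smul, inv_mul_cancel₀ hm', one_smul, gradError]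
    abel
  rw [lintegral_congr fun ω => congrArg (fun v => ENNReal.ofReal (V v)) (e ω)]
  refine h.trans_eq ?_
  rw [lintegral_const_mul' _ _ ENNReal.ofReal_ne_top, ← mul_assoc,
    ← ENNReal.ofReal_mul (by positivity), show 2 * B / m * (4 * L ^ 2) = 8 * B * L ^ 2 / m by ring]

end Estimates

/-! ### Deterministic recursions over epochs -/

section EpochRecursion

variable {Φ N D : ℕ → ℝ≥0∞} {K q : ℕ} {v β : ℝ≥0∞}

/-- The recursion is unrolled to the last refresh: `k % q` is the number of corrections made since
then, up to index `k + 1`. -/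
theorem le_add_sum_epoch (hq : 0 < q)
    (hN₁ : ∀ k, 1 ≤ k → k ≤ K → k ≡ 1 [MOD q] → N k ≤ v)
    (hN₂ : ∀ k, 1 ≤ k → k + 1 ≤ K → ¬ k + 1 ≡ 1 [MOD q] → N (k + 1) ≤ N k + β * D k)
    (k : ℕ) (hk : k + 1 ≤ K) :
    N (k + 1) ≤ v + β * ∑ j ∈ Finset.Ico (k + 1 - k % q) (k + 1), D j := by
  induction k with
  | zero => exact (hN₁ 1 le_rfl hk rfl).trans le_self_add
  | succ k ih =>
    by_cases hmod : k + 1 + 1 ≡ 1 [MOD q]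
    · exact (hN₁ _ (by omega) hk hmod).trans le_self_add
    · have hdvd : (k + 1) % q ≠ 0 := by
        intro h0
        exact hmod (Nat.ModEq.add_right 1 (show k + 1 ≡ 0 [MOD q] by simpa [Nat.ModEq] using h0))
      have hlt := Nat.mod_lt k hq
      have hmod1 : (k + 1) % q = k % q + 1 := by
        rw [← Nat.mod_add_mod] at hdvd ⊢
        rcases Nat.lt_or_ge (k % q + 1) q with h | h
        · exact Nat.mod_eq_of_lt h
        · rw [show k % q + 1 = q by omega, Nat.mod_self] at hdvd
          exact absurd rfl hdvd
      have hle := Nat.mod_le k q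
      rw [hmod1, show k + 1 + 1 - (k % q + 1) = k + 1 - k % q by omega,
        Finset.sum_Ico_succ_top (by omega), mul_add, ← add_assoc]
      exact (hN₂ (k + 1) (by omega) hk hmod).trans (by gcongr; exact ih (by omega))

/-- After exchanging the sums, each `D j` is counted only for `k` strictly between `j` and `j + q`,
hence at most `q` times. -/
theorem sum_le_of_epoch (hq : 0 < q)
    (hN₁ : ∀ k, 1 ≤ k → k ≤ K → k ≡ 1 [MOD q] → N k ≤ v)
    (hN₂ : ∀ k, 1 ≤ k → k + 1 ≤ K → ¬ k + 1 ≡ 1 [MOD q] → N (k + 1) ≤ N k + β * D k)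
    (n : ℕ) (hn : n ≤ K) :
    ∑ k ∈ Finset.Icc 1 n, N k ≤ n * v + q * β * ∑ j ∈ Finset.Ico 1 n, D j := by
  calc ∑ k ∈ Finset.Icc 1 n, N k
      ≤ ∑ k ∈ Finset.Icc 1 n,
          (v + β * ∑ j ∈ Finset.Ico 1 n, if j < k ∧ k < j + q then D j else 0) := by
        refine Finset.sum_le_sum fun k hk => ?_
        obtain ⟨h1, h2⟩ := Finset.mem_Icc.1 hk
        obtain ⟨i, rfl⟩ : ∃ i, k = i + 1 := ⟨k - 1, by omega⟩
        refine (le_add_sum_epoch hq hN₁ hN₂ i (by omega)).trans ?_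
        gcongr
        rw [← Finset.sum_filter]
        refine Finset.sum_le_sum_of_subset fun j hj => ?_
        have hlt := Nat.mod_lt i hq
        have hle := Nat.mod_le i q
        rw [Finset.mem_Ico] at hj
        rw [Finset.mem_filter, Finset.mem_Ico]
        omega
    _ = n * v + β * ∑ j ∈ Finset.Ico 1 n, ∑ k ∈ Finset.Icc 1 n,
          if j < k ∧ k < j + q then D j else 0 := by
        rw [Finset.sum_add_distrib, ← Finset.mul_sum, Finset.sum_comm, Finset.sum_const,
          Nat.card_Icc, nsmul_eq_mul, Nat.add_sub_cancel]
    _ ≤ n * v + β * ∑ j ∈ Finset.Ico 1 n, q * D j := by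
        gcongr with j hj
        rw [← Finset.sum_filter, Finset.sum_const, nsmul_eq_mul]
        gcongr
        calc ((Finset.Icc 1 n).filter fun k => j < k ∧ k < j + q).card
            ≤ (Finset.Ico j (j + q)).card := by
              refine Finset.card_le_card fun k hk => ?_
              rw [Finset.mem_filter] at hk
              rw [Finset.mem_Ico]; omega
          _ = q := by simp
    _ = _ := by rw [← Finset.mul_sum]; ring

theorem add_sum_le_of_decrease {a b : ℝ≥0∞}
    (h : ∀ k, 1 ≤ k → k ≤ K → Φ (k + 1) + a * D k ≤ Φ k + b * N k) (n : ℕ) (hn : n ≤ K) :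
    Φ (n + 1) + a * ∑ k ∈ Finset.Icc 1 n, D k ≤ Φ 1 + b * ∑ k ∈ Finset.Icc 1 n, N k := by
  induction n with
  | zero => simp
  | succ n ih =>
    rw [Finset.sum_Icc_succ_top (by omega), Finset.sum_Icc_succ_top (by omega), mul_add, mul_add]
    calc Φ (n + 1 + 1) + (a * ∑ k ∈ Finset.Icc 1 n, D k + a * D (n + 1))
        = (Φ (n + 1 + 1) + a * D (n + 1)) + a * ∑ k ∈ Finset.Icc 1 n, D k := by ring
      _ ≤ (Φ (n + 1) + b * N (n + 1)) + a * ∑ k ∈ Finset.Icc 1 n, D k := by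
          exact add_le_add (h (n + 1) (by omega) hn) le_rfl
      _ = (Φ (n + 1) + a * ∑ k ∈ Finset.Icc 1 n, D k) + b * N (n + 1) := by ring
      _ ≤ (Φ 1 + b * ∑ k ∈ Finset.Icc 1 n, N k) + b * N (n + 1) := by
          exact add_le_add (ih (by omega)) le_rfl
      _ = _ := by ring

end EpochRecursion

/-- Summation of the coupled decrease and variance recursions over all epochs. -/
theorem sum_le_of_epoch_of_decrease {Φ N D : ℕ → ℝ≥0∞} {K q : ℕ} {a b v β φ : ℝ} (hq : 0 < q)
    (ha : 0 < a) (hb : 0 ≤ b) (hv : 0 ≤ v) (hβ : 0 ≤ β) (hφ : 0 ≤ φ)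
    (hab : b * (q * β) ≤ 3 / 4 * a) (hΦ : Φ 1 = ENNReal.ofReal φ)
    (h : ∀ k, 1 ≤ k → k ≤ K →
      Φ (k + 1) + ENNReal.ofReal a * D k ≤ Φ k + ENNReal.ofReal b * N k)
    (hN₁ : ∀ k, 1 ≤ k → k ≤ K → k ≡ 1 [MOD q] → N k ≤ ENNReal.ofReal v)
    (hN₂ : ∀ k, 1 ≤ k → k + 1 ≤ K → ¬ k + 1 ≡ 1 [MOD q] →
      N (k + 1) ≤ N k + ENNReal.ofReal β * D k) :
    ∑ k ∈ Finset.Icc 1 K, D k ≤ ENNReal.ofReal (4 / a * (φ + b * (K * v))) ∧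
      ∑ k ∈ Finset.Icc 1 K, N k ≤
        ENNReal.ofReal (K * v + q * β * (4 / a * (φ + b * (K * v)))) := by
  have hsum := add_sum_le_of_decrease h
  have hN := sum_le_of_epoch hq hN₁ hN₂
  have hDN : ∀ n ≤ K, ENNReal.ofReal a * ∑ k ∈ Finset.Icc 1 n, D k ≤
      ENNReal.ofReal φ + ENNReal.ofReal b *
        (n * ENNReal.ofReal v + q * ENNReal.ofReal β * ∑ j ∈ Finset.Ico 1 n, D j) := by
    intro n hn
    refine le_add_self.trans ((hsum n hn).trans ?_)
    rw [hΦ]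
    gcongr
    exact hN n hn
  have ha0 : ENNReal.ofReal a ≠ 0 := by simpa using ha
  -- Absorption needs finiteness first. It follows by induction, since the bound for the first `n +
  -- 1` terms involves only the first `n`.
  have hfin : ∀ n ≤ K, ∑ k ∈ Finset.Icc 1 n, D k ≠ ⊤ := by
    intro n
    induction n with
    | zero => simp
    | succ n ih =>
      intro hn htop
      have h1 := hDN (n + 1) hn
      rw [htop, ENNReal.mul_top ha0, top_le_iff] at h1
      have h2 : ∑ j ∈ Finset.Ico 1 (n + 1), D j ≠ ⊤ := ih (by omega)
      exact absurd h1 (by finiteness)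
  have hT := hfin K le_rfl
  set T := ∑ k ∈ Finset.Icc 1 K, D k with hTdef
  have hsub : ∑ j ∈ Finset.Ico 1 K, D j ≤ T :=
    Finset.sum_le_sum_of_subset fun j hj => by
      rw [Finset.mem_Ico] at hj; rw [Finset.mem_Icc]; omega
  obtain ⟨t, ht0, ht⟩ : ∃ t : ℝ, 0 ≤ t ∧ T = ENNReal.ofReal t :=
    ⟨T.toReal, ENNReal.toReal_nonneg, (ENNReal.ofReal_toReal hT).symm⟩
  have hNt : ∑ k ∈ Finset.Icc 1 K, N k ≤ ENNReal.ofReal (K * v + q * β * t) := by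
    refine (hN K le_rfl).trans ((add_le_add le_rfl (mul_le_mul_right hsub _)).trans_eq ?_)
    rw [ht, ← ENNReal.ofReal_natCast K, ← ENNReal.ofReal_natCast q,
      ← ENNReal.ofReal_mul (by positivity), ← ENNReal.ofReal_mul (by positivity),
      ← ENNReal.ofReal_mul (by positivity), ← ENNReal.ofReal_add (by positivity) (by positivity)]
  have hat : a * t ≤ φ + b * (K * v + q * β * t) := by
    have h1 := le_add_self.trans (hsum K le_rfl)
    rw [← hTdef, ht, hΦ] at h1
    have h2 := h1.trans (add_le_add le_rfl (mul_le_mul_right hNt _))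
    rwa [← ENNReal.ofReal_mul ha.le, ← ENNReal.ofReal_mul hb,
      ← ENNReal.ofReal_add hφ (by positivity),
      ENNReal.ofReal_le_ofReal_iff (by positivity)] at h2
  -- By `hab` the feedback uses up at most three quarters of `a * t`; the remaining quarter gives `4
  -- / a`.
  have htle : t ≤ 4 / a * (φ + b * (K * v)) := by
    rw [div_mul_eq_mul_div, le_div_iff₀ ha]
    nlinarith [mul_le_mul_of_nonneg_right hab ht0]
  refine ⟨ht ▸ ENNReal.ofReal_le_ofReal htle, hNt.trans (ENNReal.ofReal_le_ofReal ?_)⟩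
  gcongr

/-! ### Counting samples -/

theorem card_filter_modEq_le {K q : ℕ} (hq : 0 < q) :
    ((Finset.Icc 1 K).filter fun k => k ≡ 1 [MOD q]).card ≤ ⌈(K : ℝ) / q⌉₊ := by
  have hinj : Set.InjOn (fun k => (k - 1) / q)
      ((Finset.Icc 1 K).filter fun k => k ≡ 1 [MOD q] : Finset ℕ) := by
    have hk : ∀ k ∈ ((Finset.Icc 1 K).filter fun k => k ≡ 1 [MOD q] : Finset ℕ),
        q * ((k - 1) / q) + 1 = k := by
      intro k hk
      rw [Finset.mem_filter, Finset.mem_Icc] at hk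
      have : q ∣ k - 1 := (Nat.modEq_iff_dvd' hk.1.1).1 hk.2.symm
      rw [Nat.mul_div_cancel' this]; omega
    intro k h1 j h2 he
    simp only at he
    rw [← hk k h1, ← hk j h2, he]
  have hmaps : ∀ k ∈ ((Finset.Icc 1 K).filter fun k => k ≡ 1 [MOD q] : Finset ℕ),
      (k - 1) / q ∈ Finset.range ⌈(K : ℝ) / q⌉₊ := by
    intro k hk
    rw [Finset.mem_filter, Finset.mem_Icc] at hk
    rw [Finset.mem_range, Nat.lt_ceil]
    have hq' : (0 : ℝ) < q := by exact_mod_cast hq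
    rw [lt_div_iff₀ hq']
    have h1 := Nat.div_mul_le_self (k - 1) q
    exact_mod_cast (by omega : (k - 1) / q * q < K)
  simpa using Finset.card_le_card_of_injOn _ hmaps hinj

theorem sampleCount_le {K q m m₁ : ℕ} (hq : 0 < q) :
    sampleCount K q m m₁ ≤ K * m + ⌈(K : ℝ) / q⌉₊ * m₁ := by
  unfold sampleCount batchSize
  rw [Finset.sum_ite, Finset.sum_const, Finset.sum_const, smul_eq_mul, smul_eq_mul, add_comm]
  gcongr
  · exact (Finset.card_filter_le _ _).trans_eq (by simp)
  · exact card_filter_modEq_le hq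

/-! ### Numerical constants in terms of `log d` -/

theorem log_dim_lower_bound {d : ℕ} (hd : 2 ≤ d) : (0.69 : ℝ) ≤ Real.log d := by
  have h1 : Real.log 2 ≤ Real.log d :=
    Real.log_le_log (by norm_num) (by exact_mod_cast hd)
  have := Real.log_two_gt_d9
  linarith

theorem one_le_Om {d : ℕ} (hd : 2 ≤ d) : 1 ≤ Om d := by
  have h1 := log_dim_lower_bound hd
  have h2 : (3 : ℝ) ≤ Real.exp 2 := by
    have := Real.add_one_le_exp (2 : ℝ); linarith
  unfold Om
  nlinarith

/-- The smoothness constant of the potential for `‖·‖_∞` in dimension `d`. -/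
noncomputable def smoothConst (d : ℕ) : ℝ := (2 * Real.log d + 1) * Real.exp 1

theorem smoothConst_nonneg {d : ℕ} (hd : 2 ≤ d) : 0 ≤ smoothConst d := by
  have h1 := log_dim_lower_bound hd
  unfold smoothConst; positivity

theorem exp_two_eq : Real.exp 2 = Real.exp 1 ^ 2 := by
  rw [← Real.exp_nat_mul]; norm_num

/-- With the prescribed `m₁` this makes the refresh error at most `5ε²/c`. -/
theorem two_mul_smoothConst_le {d : ℕ} (hd : 2 ≤ d) :
    2 * smoothConst d ≤ 5 * (Om d * Real.log d) := by
  have h1 := log_dim_lower_bound hd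
  have he := Real.exp_one_gt_d9
  rw [smoothConst, Om, exp_two_eq]
  set l := Real.log d
  set e := Real.exp 1
  -- This is where `0.69` is needed: at `l = 0.69` the sides are `4.76` and `4.761`.
  have h2 : 2 * (2 * l + 1) ≤ 10 * l ^ 2 := by nlinarith
  have h3 : 10 * l ^ 2 ≤ 5 * e * l ^ 2 := by nlinarith [sq_nonneg l]
  nlinarith

/-- `Ω²` carries `e⁴`: one factor `e` matches the one in `smoothConst`, and `e³` pays for the
numerical constant. With `qΩ² ≤ m` this caps the feedback over an epoch at `3L²`. -/
theorem eight_mul_smoothConst_le {d : ℕ} (hd : 2 ≤ d) : 8 * smoothConst d ≤ 3 * Om d ^ 2 := by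
  have h1 := log_dim_lower_bound hd
  have he := Real.exp_one_gt_d9
  rw [smoothConst, Om, exp_two_eq]
  set l := Real.log d
  set e := Real.exp 1
  have h2 : 8 * (2 * l + 1) ≤ 45 * l ^ 2 := by nlinarith
  have he2 : (2.7 : ℝ) ^ 3 ≤ e ^ 3 := pow_le_pow_left₀ (by norm_num) (by linarith) 3
  have h3 : 45 * l ^ 2 ≤ 3 * e ^ 3 * l ^ 2 := by
    refine mul_le_mul_of_nonneg_right ?_ (sq_nonneg l)
    norm_num at he2; linarith
  calc 8 * ((2 * l + 1) * e) = 8 * (2 * l + 1) * e := by ring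
    _ ≤ 3 * e ^ 3 * l ^ 2 * e :=
        mul_le_mul_of_nonneg_right (h2.trans h3) (by linarith)
    _ = _ := by ring

/-! ### Assembling the bound on the residual -/

section Main

variable {d : ℕ} {Ξ S : Type*} [MeasurableSpace Ξ] {P : Measure Ξ} [IsProbabilityMeasure P]
  [MeasurableSpace S] {μ : Measure S} [IsProbabilityMeasure μ]
  {X : Set (Vec d)} {F : Vec d → Ξ → ℝ} {σ L flow ρ : ℝ} {K q m m₁ : ℕ}
  {ζ : ℕ → ℕ → S → Ξ} {x G : ℕ → S → Vec d} {Y : S → ℕ}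

/-- The summed second moments of the steps and of the gradient errors. -/
theorem IsRun.sum_lintegral_le (hd : 2 ≤ d) (hP : IsProblem P X F σ L flow)
    (hS : IsSampling P μ K ζ (x 1) Y) (hL : 0 < L) (hρ : 6 ≤ ρ)
    (hR : IsRun X F (1 / L) ρ K q m m₁ ζ x G) {V : Vec d → ℝ}
    (hV : IsSmoothPotential V (smoothConst d))
    (hint : Integrable (fun ω => objective P F (x 1 ω)) μ) (hq : 0 < q) (hm : 0 < m)
    (hm₁ : 0 < m₁) (hqm : q * Om d ^ 2 ≤ m) {v : ℝ}
    (hv : 2 * smoothConst d / m₁ * σ ^ 2 ≤ v) :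
    (∑ k ∈ Finset.Icc 1 K, ∫⁻ ω, ENNReal.ofReal (l1Norm (x (k + 1) ω - x k ω) ^ 2) ∂μ ≤
      ENNReal.ofReal (24 / (L * ρ) *
        ((∫ ω, objective P F (x 1 ω) ∂μ) - flow + 3 / (2 * ρ * L) * (K * v)))) ∧
    ∑ k ∈ Finset.Icc 1 K, ∫⁻ ω, ENNReal.ofReal (V (gradError P F x G k ω)) ∂μ ≤
      ENNReal.ofReal (K * v + 3 * L ^ 2 * (24 / (L * ρ) *
        ((∫ ω, objective P F (x 1 ω) ∂μ) - flow + 3 / (2 * ρ * L) * (K * v)))) := by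
  have hB := smoothConst_nonneg hd
  have hgap : ∀ ω, 0 ≤ objective P F (x 1 ω) - flow := fun ω =>
    sub_nonneg.2 (hP.lower_bound _ (hR.init_mem ω))
  have hm' : (0 : ℝ) < m := by exact_mod_cast hm
  have hv0 : 0 ≤ v := le_trans (by positivity) hv
  have hφ : (∫ ω, objective P F (x 1 ω) ∂μ) - flow = ∫ ω, objective P F (x 1 ω) - flow ∂μ := by
    rw [integral_sub hint (integrable_const _)]; simp
  have hΦ : ∫⁻ ω, ENNReal.ofReal (objective P F (x 1 ω) - flow) ∂μ =
      ENNReal.ofReal ((∫ ω, objective P F (x 1 ω) ∂μ) - flow) := by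
    rw [hφ]
    exact (ofReal_integral_eq_lintegral_ofReal (hint.sub (integrable_const _))
      (ae_of_all _ hgap)).symm
  have hφ0 : 0 ≤ (∫ ω, objective P F (x 1 ω) ∂μ) - flow := by
    rw [hφ]; exact integral_nonneg hgap
  have hqβ : q * (8 * smoothConst d * L ^ 2 / m) ≤ 3 * L ^ 2 := by
    rw [← mul_div_assoc, div_le_iff₀ hm']
    have h1 := mul_le_mul_of_nonneg_left (eight_mul_smoothConst_le hd) (Nat.cast_nonneg (α := ℝ) q)
    have h2 : q * (8 * smoothConst d) ≤ 3 * m := by linarith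
    have h3 := mul_le_mul_of_nonneg_right h2 (sq_nonneg L)
    linarith
  -- The comparison `9L/(2ρ) ≤ Lρ/8` is exactly `ρ² ≥ 36`.
  have hab : 3 / (2 * ρ * L) * (q * (8 * smoothConst d * L ^ 2 / m)) ≤ 3 / 4 * (L * ρ / 6) := by
    refine (mul_le_mul_of_nonneg_left hqβ (by positivity)).trans ?_
    rw [div_mul_eq_mul_div, div_le_iff₀ (by positivity)]
    nlinarith [mul_le_mul hρ hρ (by norm_num) (by linarith), sq_nonneg L]
  obtain ⟨h1, h2⟩ := sum_le_of_epoch_of_decrease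
    (Φ := fun k => ∫⁻ ω, ENNReal.ofReal (objective P F (x k ω) - flow) ∂μ)
    (N := fun k => ∫⁻ ω, ENNReal.ofReal (V (gradError P F x G k ω)) ∂μ)
    (D := fun k => ∫⁻ ω, ENNReal.ofReal (l1Norm (x (k + 1) ω - x k ω) ^ 2) ∂μ)
    hq (by positivity) (by positivity) hv0 (by positivity) hφ0 hab hΦ
    (fun k h1 hk => hR.lintegral_decrease hP hS hL hρ hV h1 hk)
    (fun k h1 hk hmod => (hR.lintegral_gradError_refresh hP hS (by linarith) hV hB hm₁ h1 hk
      hmod).trans (ENNReal.ofReal_le_ofReal hv))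
    (fun k h1 hk hmod => hR.lintegral_gradError_recursion hP hS (by linarith) hV hB hm h1 hk hmod)
  have e : 4 / (L * ρ / 6) = 24 / (L * ρ) := by field_simp; norm_num
  rw [e] at h1 h2
  refine ⟨h1, h2.trans (ENNReal.ofReal_le_ofReal ?_)⟩
  gcongr

/-- The expected residual in terms of averaged second moments. -/
theorem IsRun.lintegral_stationarityResidual_le (hP : IsProblem P X F σ L flow)
    (hS : IsSampling P μ K ζ (x 1) Y) (hL : 0 < L) (hρ : 6 ≤ ρ) (hK : 0 < K)
    (hR : IsRun X F (1 / L) ρ K q m m₁ ζ x G) {V : Vec d → ℝ} {B : ℝ}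
    (hV : IsSmoothPotential V B) {ε T₁ T₂ : ℝ} (hε : 0 < ε) (hT₁ : 0 ≤ T₁) (hT₂ : 0 ≤ T₂)
    (h₁ : ∑ k ∈ Finset.Icc 1 K, ∫⁻ ω, ENNReal.ofReal (l1Norm (x (k + 1) ω - x k ω) ^ 2) ∂μ ≤
      ENNReal.ofReal (K * T₁))
    (h₂ : ∑ k ∈ Finset.Icc 1 K, ∫⁻ ω, ENNReal.ofReal (V (gradError P F x G k ω)) ∂μ ≤
      ENNReal.ofReal (K * T₂)) :
    ∫⁻ ω, stationarityResidual (objective P F) X (x (Y ω + 1) ω) ∂μ ≤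
      ENNReal.ofReal ((ρ + 2) * √ρ * L ^ 2 / (2 * ε) * T₁ + 1 / (2 * ε) * T₂ +
        ((ρ + 2) * ε / (2 * √ρ) + ε / 2)) := by
  have hs : 0 < √ρ := Real.sqrt_pos.2 (by linarith)
  have hK' : (0 : ℝ) < K := by exact_mod_cast hK
  -- `α` and `γ` come from Young's inequality. The weight `√ρ` reflects the expected step size
  -- `ε/(√ρ L)`, and balances the two resulting terms at order `√ρ ε`.
  set α := (ρ + 2) * √ρ * L ^ 2 / (2 * ε) with hα
  set γ := (ρ + 2) * ε / (2 * √ρ) + ε / 2 with hγ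
  have hα0 : 0 ≤ α := by positivity
  have hγ0 : 0 ≤ γ := by positivity
  set D : ℕ → S → ℝ≥0∞ := fun k ω => ENNReal.ofReal (l1Norm (x (k + 1) ω - x k ω) ^ 2) with hD
  set N : ℕ → S → ℝ≥0∞ := fun k ω => ENNReal.ofReal (V (gradError P F x G k ω)) with hN
  have hDm : ∀ k ∈ Finset.Icc 1 K, Measurable[past (x 1) ζ Set.univ] (D k) := by
    intro k hk
    obtain ⟨hk1, hk2⟩ := Finset.mem_Icc.1 hk
    obtain ⟨hx1, hx⟩ := hR.measurable_past hP (by linarith) k hk2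
    have hle : past (x 1) ζ {p | p.1 < k + 1} ≤ past (x 1) ζ Set.univ :=
      past_mono (Set.subset_univ _)
    exact ((l1Norm_continuous.measurable.comp ((hx1.mono hle le_rfl).sub
      ((hx hk1).1.mono hle le_rfl))).pow_const 2).ennreal_ofReal
  have hNm : ∀ k ∈ Finset.Icc 1 K, Measurable[past (x 1) ζ Set.univ] (N k) := by
    intro k hk
    obtain ⟨hk1, hk2⟩ := Finset.mem_Icc.1 hk
    exact (hV.continuous.measurable.comp ((hR.measurable_gradError_past hP (by linarith) hk1
      hk2).mono (past_mono (Set.subset_univ _)) le_rfl)).ennreal_ofReal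
  have hbound : ∀ k ∈ Finset.Icc 1 K, ∀ ω,
      stationarityResidual (objective P F) X (x (k + 1) ω) ≤
        ENNReal.ofReal α * D k ω + (ENNReal.ofReal (1 / (2 * ε)) * N k ω + ENNReal.ofReal γ) := by
    intro k hk ω
    obtain ⟨hk1, hk2⟩ := Finset.mem_Icc.1 hk
    refine (stationarityResidual_le hP.convex hP.differentiable_objective hL (by linarith)
      (hP.gradient_lipschitz hL.le) (hR.mem hk1 (by omega) ω) (hR.step k hk ω)).trans ?_
    have hVn := hV.nonneg (gradError P F x G k ω)
    rw [hD, hN]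
    simp only
    rw [← ENNReal.ofReal_mul hα0, ← ENNReal.ofReal_mul (by positivity),
      ← ENNReal.ofReal_add (by positivity) hγ0,
      ← ENNReal.ofReal_add (by positivity) (by positivity)]
    refine ENNReal.ofReal_le_ofReal ?_
    have hle := hV.linf_le (gradError P F x G k ω)
    rw [show G k ω - gradient (objective P F) (x k ω) = gradError P F x G k ω from rfl]
    set n := linfNorm (gradError P F x G k ω)
    set δ := l1Norm (x (k + 1) ω - x k ω)
    have i1 : n ≤ 1 / (2 * ε) * V (gradError P F x G k ω) + ε / 2 := by
      have : n ≤ 1 / (2 * ε) * n ^ 2 + ε / 2 := by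
        have e : 1 / (2 * ε) * n ^ 2 + ε / 2 - n = 1 / (2 * ε) * (n - ε) ^ 2 := by
          field_simp; ring
        have : 0 ≤ 1 / (2 * ε) * (n - ε) ^ 2 := by positivity
        linarith
      have h := mul_le_mul_of_nonneg_left hle (by positivity : 0 ≤ 1 / (2 * ε))
      linarith
    have i2 : (ρ + 2) * (L * δ) ≤ α * δ ^ 2 + (ρ + 2) * ε / (2 * √ρ) := by
      have e : α * δ ^ 2 + (ρ + 2) * ε / (2 * √ρ) - (ρ + 2) * (L * δ) =
          (ρ + 2) / (2 * ε * √ρ) * (√ρ * L * δ - ε) ^ 2 := by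
        rw [hα]; field_simp; ring
      have : 0 ≤ (ρ + 2) / (2 * ε * √ρ) * (√ρ * L * δ - ε) ^ 2 := by positivity
      linarith
    rw [hγ]; linarith
  refine (hS.lintegral_index_le hK
    (Q := fun k ω => stationarityResidual (objective P F) X (x (k + 1) ω))
    (R := fun k ω => ENNReal.ofReal α * D k ω +
      (ENNReal.ofReal (1 / (2 * ε)) * N k ω + ENNReal.ofReal γ))
    (fun k hk => ((hDm k hk).const_mul _).add (((hNm k hk).const_mul _).add_const _))
    hbound).trans ?_
  have hsplit : ∀ k ∈ Finset.Icc 1 K,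
      (K : ℝ≥0∞)⁻¹ * ∫⁻ ω, ENNReal.ofReal α * D k ω +
        (ENNReal.ofReal (1 / (2 * ε)) * N k ω + ENNReal.ofReal γ) ∂μ =
      (K : ℝ≥0∞)⁻¹ * (ENNReal.ofReal α * ∫⁻ ω, D k ω ∂μ +
        (ENNReal.ofReal (1 / (2 * ε)) * ∫⁻ ω, N k ω ∂μ + ENNReal.ofReal γ)) := by
    intro k hk
    have hDk := (hDm k hk).mono (hS.past_le _) le_rfl
    have hNk := (hNm k hk).mono (hS.past_le _) le_rfl
    rw [lintegral_add_left (hDk.const_mul _), lintegral_add_left (hNk.const_mul _),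
      lintegral_const_mul' _ _ ENNReal.ofReal_ne_top,
      lintegral_const_mul' _ _ ENNReal.ofReal_ne_top, lintegral_const, measure_univ, mul_one]
  rw [Finset.sum_congr rfl hsplit, ← Finset.mul_sum, Finset.sum_add_distrib,
    Finset.sum_add_distrib, ← Finset.mul_sum, ← Finset.mul_sum, Finset.sum_const, Nat.card_Icc,
    Nat.add_sub_cancel, nsmul_eq_mul]
  calc _ ≤ (K : ℝ≥0∞)⁻¹ * (ENNReal.ofReal α * ENNReal.ofReal (K * T₁) +
        (ENNReal.ofReal (1 / (2 * ε)) * ENNReal.ofReal (K * T₂) + K * ENNReal.ofReal γ)) := by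
        gcongr
    _ = _ := by
        rw [← ENNReal.ofReal_natCast K, ← ENNReal.ofReal_inv_of_pos hK',
          ← ENNReal.ofReal_mul hα0, ← ENNReal.ofReal_mul (by positivity),
          ← ENNReal.ofReal_mul hK'.le, ← ENNReal.ofReal_add (by positivity) (by positivity),
          ← ENNReal.ofReal_add (by positivity) (by positivity),
          ← ENNReal.ofReal_mul (by positivity)]
        congr 1
        field_simp
        ring

/-- The real-number estimate behind the bound on the expected residual. -/
theorem residual_bound_le {M c ρ s L ε : ℝ} (hM : 0 < M) (hc : 0 < c) (hL : 0 < L) (hε : 0 < ε)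
    (hρ : 6 ≤ ρ) (hs : 1 ≤ s) (hs2 : s ^ 2 = ρ) :
    (ρ + 2) * s * L ^ 2 / (2 * ε) * (M * ε ^ 2 / (ρ * L ^ 2)) +
      1 / (2 * ε) * ((5 / c + M) * ε ^ 2) + ((ρ + 2) * ε / (2 * s) + ε / 2) ≤
      (2 * M + 5 / c + 2) * s * ε := by
  have hs0 : 0 < s := by linarith
  have i1 : (ρ + 2) * s * L ^ 2 / (2 * ε) * (M * ε ^ 2 / (ρ * L ^ 2)) ≤ M * s * ε := by
    have e1 : (ρ + 2) * s * L ^ 2 / (2 * ε) * (M * ε ^ 2 / (ρ * L ^ 2)) =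
        (M * s * ε) * ((ρ + 2) / (2 * ρ)) := by field_simp
    rw [e1]
    refine mul_le_of_le_one_right (by positivity) ?_
    rw [div_le_one (by positivity)]; linarith
  have i2 : 1 / (2 * ε) * ((5 / c + M) * ε ^ 2) ≤ (5 / c + M) * s * ε := by
    have e2 : 1 / (2 * ε) * ((5 / c + M) * ε ^ 2) = (5 / c + M) * (1 / 2) * ε := by
      field_simp
    rw [e2]
    gcongr; linarith
  have i3 : (ρ + 2) * ε / (2 * s) ≤ s * ε := by
    rw [div_le_iff₀ (by positivity)]
    have : s * ε * (2 * s) = 2 * ρ * ε := by rw [← hs2]; ring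
    rw [this]
    gcongr; linarith
  have i4 : ε / 2 ≤ s * ε := by
    have := mul_le_mul_of_nonneg_right hs hε.le
    linarith
  have e : (2 * M + 5 / c + 2) * s * ε =
      M * s * ε + (5 / c + M) * s * ε + (s * ε + s * ε) := by ring
  rw [e]
  linarith

/-- The initial gap and the accumulated refresh noise are both multiples of `kε²/L`, the noise
because `15/(4ρ) ≤ 1`. The result is a bound per iteration. -/
theorem step_moment_le {c ρ L ε Δ k : ℝ} (hc : 0 < c) (hL : 0 < L) (hε : 0 < ε) (hρ : 6 ≤ ρ)
    (hk : 0 < k) (hΔ : Δ ≤ k * ε ^ 2 / L) :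
    24 / (L * ρ) * (Δ + 3 / (2 * ρ * L) * (k * (5 * ε ^ 2 / c))) ≤
      k * (24 * (1 + 2 / c) * ε ^ 2 / (ρ * L ^ 2)) := by
  have h1 : 3 / (2 * ρ * L) * (k * (5 * ε ^ 2 / c)) ≤ k * ε ^ 2 / L * (2 / c) := by
    have e1 : 3 / (2 * ρ * L) * (k * (5 * ε ^ 2 / c)) =
        (k * ε ^ 2 / L * (2 / c)) * (15 / (4 * ρ)) := by field_simp; norm_num
    rw [e1]
    refine mul_le_of_le_one_right (by positivity) ?_
    rw [div_le_one (by positivity)]; linarith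
  calc 24 / (L * ρ) * (Δ + 3 / (2 * ρ * L) * (k * (5 * ε ^ 2 / c)))
      ≤ 24 / (L * ρ) * (k * ε ^ 2 / L + k * ε ^ 2 / L * (2 / c)) := by gcongr
    _ = _ := by field_simp

/-- `K`, `m₁` and `m` are needed only from below, so rounding up is harmless; the epoch length
matters only through `qΩ² ≤ m`. -/
theorem IsRun.lintegral_stationarityResidual_le_of_params {c Δ ε : ℝ} (hc : 0 < c) (hd : 2 ≤ d)
    (hP : IsProblem P X F σ L flow) (hS : IsSampling P μ K ζ (x 1) Y) (hσ : 0 < σ) (hL : 0 < L)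
    (hε : 0 < ε) (hρ : 6 ≤ ρ) (hR : IsRun X F (1 / L) ρ K q m m₁ ζ x G)
    (hint : Integrable (fun ω => objective P F (x 1 ω)) μ)
    (hΔ : Δ = (∫ ω, objective P F (x 1 ω) ∂μ) - flow)
    (hΔK : Δ * L / ε ^ 2 ≤ K) (hm₁σ : Om d * (c * Real.log d) * σ ^ 2 / ε ^ 2 ≤ m₁)
    (hK : 0 < K) (hq : 0 < q) (hm : 0 < m) (hm₁ : 0 < m₁) (hqm : q * Om d ^ 2 ≤ m) :
    ∫⁻ ω, stationarityResidual (objective P F) X (x (Y ω + 1) ω) ∂μ ≤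
      ENNReal.ofReal ((2 * (24 * (1 + 2 / c)) + 5 / c + 2) * √ρ * ε) := by
  have hK' : (0 : ℝ) < K := by exact_mod_cast hK
  have hm₁' : (0 : ℝ) < m₁ := by exact_mod_cast hm₁
  obtain ⟨V, hV⟩ := exists_isSmoothPotential hd
  have hv : 2 * smoothConst d / m₁ * σ ^ 2 ≤ 5 * ε ^ 2 / c := by
    rw [div_le_iff₀ (by positivity)] at hm₁σ
    rw [div_mul_eq_mul_div, div_le_div_iff₀ hm₁' hc]
    have h3 := mul_le_mul_of_nonneg_right (two_mul_smoothConst_le hd)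
      (by positivity : 0 ≤ σ ^ 2 * c)
    linarith
  have hΔK' : Δ ≤ K * ε ^ 2 / L := by
    rw [div_le_iff₀ (by positivity)] at hΔK
    rwa [le_div_iff₀ hL]
  obtain ⟨hD, hN⟩ := hR.sum_lintegral_le hd hP hS hL hρ hV hint hq hm hm₁ hqm hv
  rw [← hΔ] at hD hN
  have hT₁ := step_moment_le hc hL hε hρ hK' hΔK'
  set M : ℝ := 24 * (1 + 2 / c) with hM
  have hM0 : 0 < M := by positivity
  have hT₂ : K * (5 * ε ^ 2 / c) + 3 * L ^ 2 * (24 / (L * ρ) *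
      (Δ + 3 / (2 * ρ * L) * (K * (5 * ε ^ 2 / c)))) ≤ K * ((5 / c + M) * ε ^ 2) := by
    calc _ ≤ K * (5 * ε ^ 2 / c) + 3 * L ^ 2 * (K * (M * ε ^ 2 / (ρ * L ^ 2))) :=
          add_le_add le_rfl (mul_le_mul_of_nonneg_left hT₁ (by positivity))
      _ = K * (5 * ε ^ 2 / c) + K * M * ε ^ 2 * (3 / ρ) := by field_simp
      _ ≤ K * (5 * ε ^ 2 / c) + K * M * ε ^ 2 * 1 := by
          gcongr; rw [div_le_one (by linarith)]; linarith
      _ = _ := by ring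
  exact (hR.lintegral_stationarityResidual_le hP hS hL hρ hK hV hε (by positivity)
    (by positivity) (hD.trans (ENNReal.ofReal_le_ofReal hT₁))
    (hN.trans (ENNReal.ofReal_le_ofReal hT₂))).trans (ENNReal.ofReal_le_ofReal
      (residual_bound_le hM0 hc hL hε hρ (Real.one_le_sqrt.2 (by linarith))
        (Real.sq_sqrt (by linarith))))

end Main

/-! ### Complexity -/

/-- The choices of `q` and `m` give `m₁ ≤ qm`, and `⌈K/q⌉ q ≤ K + q ≤ 2K`, so refreshes cost at most
twice the `Km` term. -/
theorem mul_epoch_batch_le {d K q m m₁ : ℕ} (hd : 2 ≤ d) (hq : 0 < q)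
    (hqd : Real.sqrt m₁ / Om d ≤ q) (hm : q * Om d ^ 2 ≤ m) (hqK : q ≤ K) :
    K * m + ⌈(K : ℝ) / q⌉₊ * m₁ ≤ 3 * (K * m) := by
  have hO := one_le_Om hd
  have hq' : (0 : ℝ) < q := by exact_mod_cast hq
  have hqK' : (q : ℝ) ≤ K := by exact_mod_cast hqK
  have h1 : (m₁ : ℝ) ≤ q * m := by
    rw [div_le_iff₀ (by linarith)] at hqd
    calc (m₁ : ℝ) = √m₁ ^ 2 := (Real.sq_sqrt (Nat.cast_nonneg _)).symm
      _ ≤ (q * Om d) ^ 2 := by gcongr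
      _ = q * (q * Om d ^ 2) := by ring
      _ ≤ q * m := by gcongr
  have h2 : (⌈(K : ℝ) / q⌉₊ : ℝ) * q ≤ 2 * K := by
    have h3 := Nat.ceil_lt_add_one (by positivity : 0 ≤ (K : ℝ) / q)
    calc (⌈(K : ℝ) / q⌉₊ : ℝ) * q ≤ (K / q + 1) * q := by gcongr
      _ = K + q := by field_simp
      _ ≤ 2 * K := by linarith
  have h4 : (⌈(K : ℝ) / q⌉₊ : ℝ) * m₁ ≤ 2 * K * m := by
    calc (⌈(K : ℝ) / q⌉₊ : ℝ) * m₁ ≤ ⌈(K : ℝ) / q⌉₊ * (q * m) := by gcongr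
      _ = (⌈(K : ℝ) / q⌉₊ * q) * m := by ring
      _ ≤ 2 * K * m := by gcongr
  have h5 : ⌈(K : ℝ) / q⌉₊ * m₁ ≤ 2 * K * m := by exact_mod_cast h4
  nlinarith

/-- Bounds on the sample complexity. -/
theorem complexity_bounds {d K q m m₁ : ℕ} {c σ L Δ ε : ℝ} (hc : 0 < c) (hd : 2 ≤ d)
    (hσ : 0 < σ) (hL : 0 < L) (hε : 0 < ε) (hΔ : 0 < Δ)
    (hK : K = ⌈Δ * L / ε ^ 2⌉₊)
    (hm₁ : m₁ = ⌈Om d * (c * Real.log d) * σ ^ 2 / ε ^ 2⌉₊)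
    (hq0 : 0 < q) (hq : q = ⌈Real.sqrt m₁ / Om d⌉₊) (hm : m = ⌈(q : ℝ) * Om d ^ 2⌉₊)
    (hεσ : ε ≤ σ) (hεΔ : ε * σ ≤ Δ * L) :
    (K * m : ℝ) ≤ 4 * (√(c + 1) + 1) * (Δ * L * Om d ^ 2 * σ / ε ^ 3) ∧
      (⌈(K : ℝ) / q⌉₊ * m₁ : ℝ) ≤
        (2 * √(c + 1) + (c + 1)) * (Δ * L * Om d ^ 2 * σ / ε ^ 3) := by
  have hO := one_le_Om hd
  have hl := log_dim_lower_bound hd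
  have hq' : (0 : ℝ) < q := by exact_mod_cast hq0
  set A := √(c + 1) with hA
  have hA0 : 0 ≤ A := Real.sqrt_nonneg _
  -- The smallness assumptions become `1 ≤ r ≤ J`. Here `1 ≤ r` absorbs the `+1` of each ceiling
  -- (into `c + 1` for `m₁`), and `r ≤ J` pays for the possible extra epoch, whose cost is of order
  -- `r²`.
  set r := σ / ε with hr
  have hr1 : 1 ≤ r := by rw [hr, one_le_div hε]; exact hεσ
  set J := Δ * L / ε ^ 2 with hJ
  have hJr : r ≤ J := by
    rw [hr, hJ, div_le_div_iff₀ hε (by positivity)]; nlinarith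
  have hW : Δ * L * Om d ^ 2 * σ / ε ^ 3 = J * Om d ^ 2 * r := by
    rw [hJ, hr]; field_simp
  have hKJ : (K : ℝ) ≤ 2 * J := by
    rw [hK]
    have := Nat.ceil_lt_add_one (by positivity : 0 ≤ J)
    linarith
  have hm₁le : (m₁ : ℝ) ≤ (A * Om d * r) ^ 2 := by
    have h1 : Om d * (c * Real.log d) * σ ^ 2 / ε ^ 2 ≤ c * (Om d * r) ^ 2 := by
      have h2 : Real.log d ≤ Om d := by
        unfold Om
        have := Real.add_one_le_exp (2 : ℝ)
        nlinarith
      calc Om d * (c * Real.log d) * σ ^ 2 / ε ^ 2 = c * (Om d * Real.log d * r ^ 2) := by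
            rw [hr]; field_simp
        _ ≤ c * (Om d * Om d * r ^ 2) := by gcongr
        _ = _ := by ring
    have h0 : 0 ≤ Om d * (c * Real.log d) * σ ^ 2 / ε ^ 2 := by positivity
    have h3 := Nat.ceil_lt_add_one h0
    rw [← hm₁] at h3
    have h4 : 1 ≤ (Om d * r) ^ 2 := one_le_pow₀ (one_le_mul_of_one_le_of_one_le hO hr1)
    calc (m₁ : ℝ) ≤ (c + 1) * (Om d * r) ^ 2 := by linarith
      _ = (A * Om d * r) ^ 2 := by
          rw [mul_assoc, mul_pow A, hA, Real.sq_sqrt (by positivity)]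
  have hsqrt : √m₁ ≤ A * Om d * r := Real.sqrt_le_iff.2 ⟨by positivity, hm₁le⟩
  have hqle : (q : ℝ) ≤ (A + 1) * r := by
    have h1 := Nat.ceil_lt_add_one (by positivity : 0 ≤ √m₁ / Om d)
    rw [← hq] at h1
    have h2 : √m₁ / Om d ≤ A * r := by
      rw [div_le_iff₀ (by linarith)]; linarith
    linarith
  have hmle : (m : ℝ) ≤ 2 * ((A + 1) * r * Om d ^ 2) := by
    have h1 := Nat.ceil_lt_add_one (by positivity : 0 ≤ (q : ℝ) * Om d ^ 2)
    rw [← hm] at h1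
    have h2 : 1 ≤ (q : ℝ) * Om d ^ 2 :=
      one_le_mul_of_one_le_of_one_le (by exact_mod_cast hq0) (one_le_pow₀ hO)
    have h3 : (q : ℝ) * Om d ^ 2 ≤ (A + 1) * r * Om d ^ 2 := by gcongr
    linarith
  have hm₁q : (m₁ : ℝ) ≤ q * (A * Om d ^ 2 * r) := by
    have h1 : √m₁ ≤ q * Om d := by
      have := Nat.le_ceil (√m₁ / Om d)
      rw [← hq, div_le_iff₀ (by linarith)] at this
      exact this
    calc (m₁ : ℝ) = √m₁ * √m₁ := (Real.mul_self_sqrt (Nat.cast_nonneg _)).symm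
      _ ≤ (q * Om d) * (A * Om d * r) := by gcongr
      _ = _ := by ring
  rw [hW]
  constructor
  · calc (K * m : ℝ) ≤ (2 * J) * (2 * ((A + 1) * r * Om d ^ 2)) := by gcongr
      _ = _ := by ring
  · have h3 := Nat.ceil_lt_add_one (by positivity : 0 ≤ (K : ℝ) / q)
    calc (⌈(K : ℝ) / q⌉₊ * m₁ : ℝ) ≤ (K / q + 1) * m₁ := by gcongr
      _ = K / q * m₁ + m₁ := by ring
      _ ≤ K / q * (q * (A * Om d ^ 2 * r)) + (A * Om d * r) ^ 2 := by gcongr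
      _ = K * (A * Om d ^ 2 * r) + A ^ 2 * (r * Om d ^ 2 * r) := by field_simp
      _ ≤ (2 * J) * (A * Om d ^ 2 * r) + A ^ 2 * (J * Om d ^ 2 * r) := by gcongr
      _ = _ := by rw [hA, Real.sq_sqrt (by positivity)]; ring

end DISFOM

/-! ### The complexity theorem -/

theorem corollary2 (c : ℝ) (hc : 0 < c) :
    ∃ C : ℝ, 0 < C ∧
      ∀ (d : ℕ) (_ : 2 ≤ d)
        (Ξ : Type*) [MeasurableSpace Ξ] (P : Measure Ξ) [IsProbabilityMeasure P]
        (S : Type*) [MeasurableSpace S] (μ : Measure S) [IsProbabilityMeasure μ]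
        (X : Set (DISFOM.Vec d)) (F : DISFOM.Vec d → Ξ → ℝ)
        (σ L flow Δf ε η ρ : ℝ) (K q m m₁ : ℕ)
        (ζ : ℕ → ℕ → S → Ξ) (x G : ℕ → S → DISFOM.Vec d) (Y : S → ℕ),
        0 < σ → 0 < L → 0 < ε → 6 ≤ ρ →
        DISFOM.IsProblem P X F σ L flow →
        DISFOM.IsSampling P μ K ζ (x 1) Y →
        DISFOM.IsRun X F η ρ K q m m₁ ζ x G →
        Integrable (fun ω => DISFOM.objective P F (x 1 ω)) μ →
        Δf = (∫ ω, DISFOM.objective P F (x 1 ω) ∂μ) - flow →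
        0 < Δf →
        η = 1 / L →
        K = ⌈Δf * L / ε ^ 2⌉₊ →
        m₁ = ⌈DISFOM.Om d * (c * Real.log d) * σ ^ 2 / ε ^ 2⌉₊ →
        q = ⌈Real.sqrt m₁ / DISFOM.Om d⌉₊ →
        m = ⌈(q : ℝ) * DISFOM.Om d ^ 2⌉₊ →
        -- the expected residual of the output
        (∫⁻ ω, DISFOM.stationarityResidual (DISFOM.objective P F) X (x (Y ω + 1) ω) ∂μ
            ≤ ENNReal.ofReal (C * Real.sqrt ρ * ε)) ∧
        -- the number of samples
        DISFOM.sampleCount K q m m₁ ≤ K * m + ⌈(K : ℝ) / q⌉₊ * m₁ ∧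
        (q ≤ K → K * m + ⌈(K : ℝ) / q⌉₊ * m₁ ≤ 3 * (K * m)) ∧
        (ε ≤ σ → ε * σ ≤ Δf * L →
          (K * m + ⌈(K : ℝ) / q⌉₊ * m₁ : ℝ) ≤ C * (Δf * L * DISFOM.Om d ^ 2 * σ / ε ^ 3) ∧
          (3 * (K * m) : ℝ) ≤ C * (Δf * L * DISFOM.Om d ^ 2 * σ / ε ^ 3) ∧
          (K * m + ⌈(K : ℝ) / q⌉₊ * m₁ : ℝ) ≤
            C * (Δf * L * Real.log d ^ 2 * σ / ε ^ 3)) := by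
  set M : ℝ := 24 * (1 + 2 / c) with hM
  set C₁ : ℝ := 2 * M + 5 / c + 2 with hC₁
  set A : ℝ := √(c + 1) with hA
  set C₂ : ℝ := 4 * (A + 1) + (2 * A + (c + 1)) with hC₂
  have hM0 : 0 < M := by positivity
  have hC₁0 : 0 < C₁ := by positivity
  have hA0 : 0 ≤ A := Real.sqrt_nonneg _
  have hC₂0 : 0 < C₂ := by positivity
  have hexp : 1 ≤ Real.exp 2 ^ 2 := one_le_pow₀ (Real.one_le_exp (by norm_num))
  -- `C₁` serves the residual, `12(A + 1)` is three times the constant for `Km`, and `e⁴C₂` serves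
  -- the total count, including its form with `Ω² = e⁴ (log d)²` expanded.
  refine ⟨C₁ + 12 * (A + 1) + Real.exp 2 ^ 2 * C₂, by positivity, ?_⟩
  intro d hd Ξ _ P _ S _ μ _ X F σ L flow Δf ε η ρ K q m m₁ ζ x G Y hσ hL hε hρ hP hS hR hint
    hΔ hΔ0 hη hK hm₁ hq hm
  subst hη
  have hO := DISFOM.one_le_Om hd
  have hl := DISFOM.log_dim_lower_bound hd
  have hl0 : 0 < Real.log d := by linarith
  have hK0 : 0 < K := by rw [hK]; exact Nat.ceil_pos.2 (by positivity)
  have hm₁0 : 0 < m₁ := by rw [hm₁]; exact Nat.ceil_pos.2 (by positivity)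
  have hm₁' : (0 : ℝ) < m₁ := by exact_mod_cast hm₁0
  have hq0 : 0 < q := by
    rw [hq]; exact Nat.ceil_pos.2 (div_pos (Real.sqrt_pos.2 hm₁') (by linarith))
  have hq' : (0 : ℝ) < q := by exact_mod_cast hq0
  have hm0 : 0 < m := by rw [hm]; exact Nat.ceil_pos.2 (by positivity)
  have hK' : (0 : ℝ) < K := by exact_mod_cast hK0
  have hqm : (q : ℝ) * DISFOM.Om d ^ 2 ≤ m := by rw [hm]; exact Nat.le_ceil _
  refine ⟨?_, DISFOM.sampleCount_le hq0, fun hqK =>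
    DISFOM.mul_epoch_batch_le hd hq0 (by rw [hq]; exact Nat.le_ceil _) hqm hqK, fun h1 h2 => ?_⟩
  · refine (hR.lintegral_stationarityResidual_le_of_params hc hd hP hS hσ hL hε hρ hint hΔ
      (by rw [hK]; exact Nat.le_ceil _) (by rw [hm₁]; exact Nat.le_ceil _) hK0 hq0 hm0 hm₁0
      hqm).trans (ENNReal.ofReal_le_ofReal ?_)
    rw [← hM, ← hC₁]
    have h0 : 0 ≤ 12 * (A + 1) + Real.exp 2 ^ 2 * C₂ := by positivity
    gcongr
    linarith
  · obtain ⟨b1, b2⟩ := DISFOM.complexity_bounds hc hd hσ hL hε hΔ0 hK hm₁ hq0 hq hm h1 h2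
    rw [← hA] at b1 b2
    have hW0 : 0 ≤ Δf * L * DISFOM.Om d ^ 2 * σ / ε ^ 3 := by positivity
    have hWe : Δf * L * DISFOM.Om d ^ 2 * σ / ε ^ 3 =
        Real.exp 2 ^ 2 * (Δf * L * Real.log d ^ 2 * σ / ε ^ 3) := by
      rw [DISFOM.Om]; ring
    have hU0 : 0 ≤ Δf * L * Real.log d ^ 2 * σ / ε ^ 3 := by positivity
    have hC₂' : C₂ ≤ Real.exp 2 ^ 2 * C₂ := le_mul_of_one_le_left hC₂0.le hexp
    have hsum : (K * m + ⌈(K : ℝ) / q⌉₊ * m₁ : ℝ) ≤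
        C₂ * (Δf * L * DISFOM.Om d ^ 2 * σ / ε ^ 3) := by rw [hC₂]; linarith
    refine ⟨hsum.trans ?_, ?_, hsum.trans ?_⟩
    · exact mul_le_mul_of_nonneg_right (by linarith) hW0
    · refine le_trans (by linarith : (3 * (K * m) : ℝ) ≤
        12 * (A + 1) * (Δf * L * DISFOM.Om d ^ 2 * σ / ε ^ 3)) ?_
      exact mul_le_mul_of_nonneg_right (by linarith) hW0
    · rw [hWe, ← mul_assoc, mul_comm C₂]
      exact mul_le_mul_of_nonneg_right (by linarith) hU0
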